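/- Let $L$ be a first-order alphabet with at least one constant and a denumerable set of variables. A query is a formula built from $\mathrm{TRUE}$, $\mathrm{FALSE}$, equations and atoms using $\wedge$ and $\exists$; $|Q|$ is the number of atoms occurring in $Q$. A pre-interpretation $J$ is a non-empty domain with an interpretation of the function symbols of $L$; $=$ is identity. An interpretation based on $J$ is a set of generalized atoms $p(d_1,\dots,d_n)$ with $d_i$ in the domain of $J$; a multiinterpretation $\overline I$ for $Q$ is a sequence of $|Q|$ of them. The solution set $\mathrm{Sol}_J(Q,\overline I)$ is the set of valuations over $J$ that satisfy $Q$ when its $j$-th atom (from left to right) is evaluated in the $j$-th component of $\overline I$. Write $Q\preceq_J Q'$ (respectively $Q\approx_J Q'$) if $|Q|=|Q'|$ and $\mathrm{Sol}_J(Q,\overline I)\subseteq \mathrm{Sol}_J(Q',\overline I)$ (respectively $=$) for all multiinterpretations $\overline I$ for $Q$ based on $J$. The free equality axioms $\mathrm{FEA}(L)$ are: $f(x_1,\dots,x_n)=f(y_1,\dots,y_n)\leftrightarrow x_1=y_1\wedge\dots\wedge x_n=y_n$ for each $n$-ary function symbol $f$; $f(x_1,\dots,x_n)=g(y_1,\dots,y_m)\leftrightarrow\mathrm{FALSE}$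 for distinct function symbols $f,g$ (constants included); $x=t\leftrightarrow\mathrm{FALSE}$ whenever the variable $x$ occurs in the term $t$ and $t\not\equiv x$. Write $Q\preceq Q'$ if $Q\preceq_J Q'$ for every pre-interpretation $J$ that is a model of $\mathrm{FEA}(L)$, and $Q\approx Q'$ ($Q$ and $Q'$ are equivalent) if $Q\preceq Q'$ and $Q'\preceq Q$. A model of $\mathrm{FEA}(L)$ is non-trivial if its domain has at least two elements. A query is in solved form if it is $\mathrm{TRUE}$ or $\mathrm{FALSE}$, or has the form $(\exists z_1)\dots(\exists z_k)(x_1=s_1\wedge\dots\wedge x_n=s_n\wedge A_1\wedge\dots\wedge A_m)$ (the bracketing of the conjunction is immaterial), where the variables $x_i$ and $z_j$ are all distinct, no $x_i$ occurs in any $s_j$ or $A_j$, every $z_j$ occurs in the conjunction, and $z_j\not\equiv s_i$ for all $i,j$. A query $Q'$ is isomorphic to a query $Q$ in solved form if it is obtained from $Q$ by finitely many steps of the following types: (a) permuting the equations and permuting the quantifiers $\exists z_j$ (the order of the atoms is kept); (b) renaming bound variables, i.e. replacing a part $(\exists x)G$ by $(\exists y)G_x[y]$, where $y$ is not free in $G$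 and is substitutible for $x$ in $G$; (c) redirecting equations, i.e. simultaneously exchanging $u_i$ and $v_i$ for $i=1,\dots,k$ in the whole query, where $u_1=v_1,\dots,u_k=v_k$ are equations of the query between variables and $u_1,\dots,u_k,v_1,\dots,v_k$ are distinct. **Theorem.** If $J$ is a non-trivial model of $\mathrm{FEA}(L)$, then for all queries $Q$ and $Q'$: 1. $Q\approx_J Q'$ if and only if $Q\approx Q'$; 2. $Q\preceq_J Q'$ if and only if $Q\preceq Q'$. Moreover, if $Q$ and $Q'$ are equivalent queries in solved form, then they are isomorphic. -/

import Mathlib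

universe u v w w'

namespace QueryLattice

/-- The function-symbol part of an alphabet `L`. A structure for this language interprets exactly
the function symbols of `L`, so it is a pre-interpretation for `L`. -/
abbrev fnPart (L : FirstOrder.Language.{u, v}) : FirstOrder.Language.{u, 0} := ⟨L.Functions, fun _ => Empty⟩

/-- Terms over `L`; the denumerable set of variables is `ℕ`. -/
abbrev Tm (L : FirstOrder.Language.{u, v}) : Type u := (fnPart L).Term ℕ

/-- The free equality axioms of `L`, as a set of formulas without predicate symbols.
In the first two groups the variables `x₁, …, xₙ` are `0, …, n - 1` and the variables
`y₁, …, yₘ` are `n, …, n + m - 1`. -/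
inductive FEA (L : FirstOrder.Language.{u, v}) : (fnPart L).Formula ℕ → Prop
  | inj {n : ℕ} (f : L.Functions n) :
      FEA L (FirstOrder.Language.BoundedFormula.iff
        (FirstOrder.Language.Term.equal
          (FirstOrder.Language.Term.func (L := fnPart L) f fun i => FirstOrder.Language.Term.var (i : ℕ))
          (FirstOrder.Language.Term.func (L := fnPart L) f fun i => FirstOrder.Language.Term.var (n + (i : ℕ))))
        (FirstOrder.Language.BoundedFormula.iInf fun i : Fin n =>
          FirstOrder.Language.Term.equal (L := fnPart L) (FirstOrder.Language.Term.var (i : ℕ))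
            (FirstOrder.Language.Term.var (n + (i : ℕ)))))
  | clash {n m : ℕ} (f : L.Functions n) (g : L.Functions m)
      (hfg : (⟨n, f⟩ : Σ k, L.Functions k) ≠ ⟨m, g⟩) :
      FEA L (FirstOrder.Language.BoundedFormula.iff
        (FirstOrder.Language.Term.equal
          (FirstOrder.Language.Term.func (L := fnPart L) f fun i => FirstOrder.Language.Term.var (i : ℕ))
          (FirstOrder.Language.Term.func (L := fnPart L) g fun i => FirstOrder.Language.Term.var (n + (i : ℕ))))
        ⊥)
  | occurs (x : ℕ) (t : Tm L) (hne : t ≠ FirstOrder.Language.Term.var x) (hx : x ∈ t.varFinset) :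
      FEA L (FirstOrder.Language.BoundedFormula.iff
        (FirstOrder.Language.Term.equal (L := fnPart L) (FirstOrder.Language.Term.var x) t) ⊥)

/-- The pre-interpretation `J` is a model for the free equality axioms of `L`: every axiom is true
in `J` under every valuation. -/
def IsModelFEA (L : FirstOrder.Language.{u, v}) (J : Type w) [(fnPart L).Structure J] : Prop :=
  ∀ φ : (fnPart L).Formula ℕ, FEA L φ → ∀ h : ℕ → J, φ.Realize h

/-- A predicate symbol of `L` applied to a tuple of elements of `X`. For `X = Tm L` these are the
atoms; for a pre-interpretation `J` they form the `J`-base. -/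
structure GAtom (L : FirstOrder.Language.{u, v}) (X : Type w) where
  /-- the number of arguments -/
  arity : ℕ
  /-- the predicate symbol -/
  rel : L.Relations arity
  /-- the arguments -/
  args : Fin arity → X

/-- The generalized atom `h(A)`, for a function `h` on the arguments. -/
def GAtom.map {L : FirstOrder.Language.{u, v}} {X : Type w} {Y : Type w'} (h : X → Y) (A : GAtom L X) :
    GAtom L Y :=
  ⟨A.arity, A.rel, fun i => h (A.args i)⟩

/-- The variables of an atom. -/
def GAtom.vars {L : FirstOrder.Language.{u, v}} (A : GAtom L (Tm L)) : Finset ℕ :=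
  Finset.univ.biUnion fun i => (A.args i).varFinset

/-- An interpretation based on `J`, identified with a subset of the `J`-base. -/
abbrev Interp (L : FirstOrder.Language.{u, v}) (J : Type w) := Set (GAtom L J)

/-- Positive conjunctive queries. -/
inductive Query (L : FirstOrder.Language.{u, v})
  | tru : Query L
  | fls : Query L
  | eq (s t : Tm L) : Query L
  | atom (A : GAtom L (Tm L)) : Query L
  | and (Q₁ Q₂ : Query L) : Query L
  | ex (x : ℕ) (Q : Query L) : Query L

namespace Query

variable {L : FirstOrder.Language.{u, v}}

/-- The number `|Q|` of atoms occurring in `Q`. -/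
def card : Query L → ℕ
  | tru => 0
  | fls => 0
  | eq _ _ => 0
  | atom _ => 1
  | and Q₁ Q₂ => Q₁.card + Q₂.card
  | ex _ Q => Q.card

/-- The set of solutions of `Q` in a multiinterpretation based on `J`. It is only meaningful for a
multiinterpretation of length `Q.card`, and is only used for those. -/
def sol (J : Type w) [(fnPart L).Structure J] : Query L → List (Interp L J) → Set (ℕ → J)
  | tru, _ => Set.univ
  | fls, _ => ∅
  | eq s t, _ => {h | s.realize h = t.realize h}
  | atom A, Is => {h | ∃ I, Is = [I] ∧ A.map (fun t => t.realize h) ∈ I}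
  | and Q₁ Q₂, Is => sol J Q₁ (Is.take Q₁.card) ∩ sol J Q₂ (Is.drop Q₁.card)
  | ex x Q, Is => {h | ∃ d : J, Function.update h x d ∈ sol J Q Is}

/-- The preorder `Q ⪯_J Q'`. -/
def LeJ (J : Type w) [(fnPart L).Structure J] (Q Q' : Query L) : Prop :=
  Q.card = Q'.card ∧
    ∀ Is : List (Interp L J), Is.length = Q.card → Q.sol J Is ⊆ Q'.sol J Is

/-- The equivalence `Q ≈_J Q'`. -/
def EquivJ (J : Type w) [(fnPart L).Structure J] (Q Q' : Query L) : Prop :=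
  Q.card = Q'.card ∧
    ∀ Is : List (Interp L J), Is.length = Q.card → Q.sol J Is = Q'.sol J Is

/-- `Q ⪯ Q'`: the query `Q'` is more general than `Q`, that is, `Q ⪯_J Q'` for every
pre-interpretation `J` (with domain in `Type w`) that is a model for the free equality axioms. -/
def Le (Q Q' : Query L) : Prop :=
  ∀ (J : Type w) [Nonempty J] [(fnPart L).Structure J], IsModelFEA L J → LeJ J Q Q'

/-- `Q ≈ Q'`: the queries are equivalent. -/
def Equivalent (Q Q' : Query L) : Prop := Le.{u, v, w} Q Q' ∧ Le.{u, v, w} Q' Q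

/-- The free variables of a query. -/
def freeVars : Query L → Finset ℕ
  | tru => ∅
  | fls => ∅
  | eq s t => s.varFinset ∪ t.varFinset
  | atom A => A.vars
  | and Q₁ Q₂ => Q₁.freeVars ∪ Q₂.freeVars
  | ex x Q => Q.freeVars.erase x

/-- Simultaneous replacement of the free occurrences of each variable `x` by `σ x`. -/
def subst : (ℕ → Tm L) → Query L → Query L
  | _, tru => tru
  | _, fls => fls
  | σ, eq s t => eq (s.subst σ) (t.subst σ)
  | σ, atom A => atom (A.map fun t => t.subst σ)
  | σ, and Q₁ Q₂ => and (subst σ Q₁) (subst σ Q₂)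
  | σ, ex x Q => ex x (subst (Function.update σ x (FirstOrder.Language.Term.var x)) Q)

/-- For every variable `x`, the term `σ x` is substitutible for `x` in the query: no free
occurrence of `x` is in the scope of a quantifier on a variable of `σ x` (unless `σ x` is `x`). -/
def Substitutible : (ℕ → Tm L) → Query L → Prop
  | _, tru => True
  | _, fls => True
  | _, eq _ _ => True
  | _, atom _ => True
  | σ, and Q₁ Q₂ => Substitutible σ Q₁ ∧ Substitutible σ Q₂
  | σ, ex y Q => (∀ x ∈ Q.freeVars, x ≠ y → y ∉ (σ x).varFinset) ∧
      Substitutible (Function.update σ y (FirstOrder.Language.Term.var y)) Q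

/-- The substitution of the variable `y` for the variable `x`. -/
def single (x y : ℕ) : ℕ → Tm L :=
  Function.update FirstOrder.Language.Term.var x (FirstOrder.Language.Term.var y)

/-- One renaming of a bound variable: a part `(∃x) G` is replaced by `(∃y) G_x[y]`, where `y` is
not free in `G` and is substitutible for `x` in `G`. -/
inductive RenameStep : Query L → Query L → Prop
  | here (x y : ℕ) (G : Query L) (hy : y ∉ G.freeVars) (hs : Substitutible (single x y) G) :
      RenameStep (ex x G) (ex y (subst (single x y) G))
  | andLeft {G G' : Query L} (H : Query L) : RenameStep G G' → RenameStep (and G H) (and G' H)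
  | andRight {G G' : Query L} (H : Query L) : RenameStep G G' → RenameStep (and H G) (and H G')
  | ex (x : ℕ) {G G' : Query L} : RenameStep G G' → RenameStep (ex x G) (ex x G')

/-- `Q'` is a variant of `Q`. -/
def Variant (Q Q' : Query L) : Prop := Relation.ReflTransGen RenameStep Q Q'

/-- The query `(∃z₁) … (∃zₖ) Q`. -/
def exs (zs : List ℕ) (Q : Query L) : Query L := zs.foldr ex Q

/-- The members, from left to right, of a conjunction that may be bracketed in any way. -/
def conjuncts : Query L → List (Query L)
  | and Q₁ Q₂ => Q₁.conjuncts ++ Q₂.conjuncts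
  | Q => [Q]

/-- `Q` is `(∃z₁) … (∃zₖ) B` where `B` is the conjunction
`x₁ = s₁ ∧ … ∧ xₙ = sₙ ∧ A₁ ∧ … ∧ Aₘ`, whose bracketing is immaterial. Here `eqs` lists the pairs
`(xᵢ, sᵢ)`. -/
def HasForm (Q : Query L) (zs : List ℕ) (eqs : List (ℕ × Tm L)) (atoms : List (GAtom L (Tm L))) :
    Prop :=
  ∃ B : Query L, Q = exs zs B ∧
    B.conjuncts = eqs.map (fun e => eq (FirstOrder.Language.Term.var e.1) e.2) ++ atoms.map atom

/-- `Q` is in solved form. -/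
def Solved (Q : Query L) : Prop :=
  Q = tru ∨ Q = fls ∨
    ∃ (zs : List ℕ) (eqs : List (ℕ × Tm L)) (atoms : List (GAtom L (Tm L))),
      Q.HasForm zs eqs atoms ∧
      (eqs.map Prod.fst ++ zs).Nodup ∧
      (∀ x ∈ eqs.map Prod.fst,
        (∀ e ∈ eqs, x ∉ e.2.varFinset) ∧ ∀ A ∈ atoms, x ∉ A.vars) ∧
      (∀ z ∈ zs, (∃ e ∈ eqs, z ∈ e.2.varFinset) ∨ ∃ A ∈ atoms, z ∈ A.vars) ∧
      (∀ z ∈ zs, ∀ e ∈ eqs, e.2 ≠ FirstOrder.Language.Term.var z)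

/-- Permutation of equations and of bound variables. -/
def PermStep (Q Q' : Query L) : Prop :=
  ∃ (zs zs' : List ℕ) (eqs eqs' : List (ℕ × Tm L)) (atoms : List (GAtom L (Tm L))),
    Q.HasForm zs eqs atoms ∧ Q'.HasForm zs' eqs' atoms ∧ zs.Perm zs' ∧ eqs.Perm eqs'

/-- The substitution that exchanges `u` and `v` for each pair `(u, v)` of the list (whose entries
are to be distinct variables). -/
def swap : List (ℕ × ℕ) → ℕ → Tm L
  | [] => FirstOrder.Language.Term.var
  | p :: ps => Function.update (Function.update (swap ps) p.1 (FirstOrder.Language.Term.var p.2))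
      p.2 (FirstOrder.Language.Term.var p.1)

/-- Redirecting equations `u₁ = v₁, …, uₖ = vₖ` of `Q` between variables: `uᵢ` and `vᵢ` are
exchanged simultaneously throughout `Q`. -/
def RedirectStep (Q Q' : Query L) : Prop :=
  ∃ (zs : List ℕ) (eqs : List (ℕ × Tm L)) (atoms : List (GAtom L (Tm L))) (ps : List (ℕ × ℕ)),
    Q.HasForm zs eqs atoms ∧
    (∀ p ∈ ps, (p.1, FirstOrder.Language.Term.var p.2) ∈ eqs) ∧
    (ps.map Prod.fst ++ ps.map Prod.snd).Nodup ∧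
    Substitutible (swap ps) Q ∧
    Q' = subst (swap ps) Q

/-- `Q'` is isomorphic to the query `Q` in solved form. -/
def Isomorphic (Q Q' : Query L) : Prop :=
  Q.Solved ∧
    Relation.ReflTransGen (fun R R' => PermStep R R' ∨ Variant R R' ∨ RedirectStep R R') Q Q'

end Query

end QueryLattice

namespace QueryLattice

open FirstOrder.Language FirstOrder.Language.Structure

variable {L : FirstOrder.Language.{u, v}}

/-! ### Terms, substitution and the occurs check -/

section Terms

/-! Unification describes the solutions of equations uniformly in all models of the free equality
axioms. A finite set of equations either entails something that the axioms refute, or has a unifier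
θ such that every equation x = θ(x) follows from the set (`exists_mgu`). In the second case its
solutions in any model are exactly the valuations "θ evaluated at k".

Parts 1 and 2 reduce to one statement, `LeJ.transfer`: Q ⪯_J Q' in a single non-trivial model J
passes to every model J'. Let h solve Q in J', and let θ be a most general unifier of the equations
of a prenex form of Q with atoms A_j. For each valuation k over J, θ evaluated at k solves Q when
the components are the singletons holding the evaluated atoms A_jθ; hence it solves Q' there. As k
is arbitrary, the witnesses for Q' can be chosen uniformly. Indeed, when the conditions imposed by
Q' are unified, no parameter is bound to a constant or compound term, because its value is
unrestricted and the model is non-trivial, and no two parameters are identified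
(`exists_generic_solution`). So θ solves Q' in the model of terms, with components {A_jθ}. Positive
queries are preserved by homomorphisms (`sol_map`), and evaluating terms at the witness for h
carries this solution back to J'.

For solved forms, the equations read as a substitution give a generic solution in the model of
terms, with components {A_j}. Testing each of two equivalent solved forms on the generic solution of
the other yields substitutions g and g' that make each an instance of the other. They are mutually
inverse on the variables that matter, so they are renamings there. They match bound variables with
bound variables, and a free variable x eliminated on one side only is eliminated by x = y with y = x
on the other side. Redirecting these equations, renaming bound variables and permuting turns one
form into the other (`Instances.substAtoms_total`, `Instances.eqs_perm`). -/

theorem realize_congr_vars {J : Type w} [(fnPart L).Structure J] {t : Tm L} {g h : ℕ → J}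
    (H : ∀ x ∈ t.varFinset, g x = h x) : t.realize g = t.realize h := by
  induction t with
  | var x => exact H x (by simp)
  | func f ts ih =>
    simp only [Term.realize_func]
    congr 1
    funext i
    exact ih i fun x hx => H x (by simpa using ⟨i, hx⟩)

theorem subst_congr_vars {t : Tm L} {g h : ℕ → Tm L}
    (H : ∀ x ∈ t.varFinset, g x = h x) : t.subst g = t.subst h := by
  induction t with
  | var x => exact H x (by simp)
  | func f ts ih =>
    simp only [Term.subst]
    congr 1
    funext i
    exact ih i fun x hx => H x (by simpa using ⟨i, hx⟩)

theorem eq_of_subst_eq {t : Tm L} {g h : ℕ → Tm L} (H : t.subst g = t.subst h) {x : ℕ}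
    (hx : x ∈ t.varFinset) : g x = h x := by
  induction t with
  | var y =>
    simp only [Term.varFinset, Finset.mem_singleton] at hx
    subst hx
    exact H
  | func f ts ih =>
    simp only [Term.varFinset, Finset.mem_biUnion, Finset.mem_univ, true_and] at hx
    obtain ⟨i, hi⟩ := hx
    simp only [Term.subst, Term.func.injEq, heq_eq_eq, true_and] at H
    exact ih i (congrFun H i) hi

theorem subst_var (t : Tm L) : t.subst Term.var = t := by
  induction t with
  | var x => rfl
  | func f ts ih => simp only [Term.subst, ih]

theorem subst_subst (t : Tm L) (g h : ℕ → Tm L) :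
    (t.subst g).subst h = t.subst fun x => (g x).subst h := by
  induction t with
  | var x => rfl
  | func f ts ih => simp only [Term.subst, ih]

theorem subst_eq_self {t : Tm L} {g : ℕ → Tm L} (H : ∀ x ∈ t.varFinset, g x = Term.var x) :
    t.subst g = t :=
  (subst_congr_vars H).trans (subst_var t)

theorem mem_varFinset_subst {t : Tm L} {g : ℕ → Tm L} {y : ℕ} :
    y ∈ (t.subst g).varFinset ↔ ∃ x ∈ t.varFinset, y ∈ (g x).varFinset := by
  induction t with
  | var x => simp [Term.subst]
  | func f ts ih =>
    simp only [Term.subst, Term.varFinset, Finset.mem_biUnion, Finset.mem_univ, true_and, ih]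
    constructor
    · rintro ⟨i, x, hx, hy⟩
      exact ⟨x, ⟨i, hx⟩, hy⟩
    · rintro ⟨x, ⟨i, hx⟩, hy⟩
      exact ⟨i, x, hx, hy⟩

/-- The number of symbols of a term. -/
def termSize : Tm L → ℕ
  | Term.var _ => 1
  | Term.func _ ts => 1 + ∑ i, termSize (ts i)

/-- The terms as a pre-interpretation. -/
instance termStructure : (fnPart L).Structure (Tm L) where
  funMap f ts := Term.func f ts
  RelMap r := r.elim

theorem realize_eq_subst (t : Tm L) (g : ℕ → Tm L) : t.realize g = t.subst g := by
  induction t with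
  | var x => rfl
  | func f ts ih =>
    simp only [Term.realize_func, Term.subst, ← ih]
    rfl

theorem termSize_le_subst {t : Tm L} {x : ℕ} (hx : x ∈ t.varFinset) (g : ℕ → Tm L) :
    termSize (g x) ≤ termSize (t.subst g) := by
  induction t with
  | var y =>
    simp only [Term.varFinset, Finset.mem_singleton] at hx
    subst hx
    exact le_rfl
  | func f ts ih =>
    simp only [Term.varFinset, Finset.mem_biUnion, Finset.mem_univ, true_and] at hx
    obtain ⟨i, hi⟩ := hx
    simp only [Term.subst, termSize]
    have := Finset.single_le_sum (f := fun i => termSize ((ts i).subst g))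
      (fun _ _ => Nat.zero_le _) (Finset.mem_univ i)
    have h2 := ih i hi
    omega

/-- Here `x` lies properly inside `t`, so the instance of `t` has strictly more symbols than `g x`.
This is the occurs axiom in the model of terms. -/
theorem subst_ne_of_mem {t : Tm L} {x : ℕ} (hne : t ≠ Term.var x) (hx : x ∈ t.varFinset)
    (g : ℕ → Tm L) : g x ≠ t.subst g := by
  intro H
  cases t with
  | var y =>
    simp only [Term.varFinset, Finset.mem_singleton] at hx
    exact hne (by rw [hx])
  | func f ts =>
    simp only [Term.varFinset, Finset.mem_biUnion, Finset.mem_univ, true_and] at hx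
    obtain ⟨i, hi⟩ := hx
    have h2 := termSize_le_subst hi g
    rw [H] at h2
    simp only [Term.subst, termSize] at h2
    have := Finset.single_le_sum (f := fun i => termSize ((ts i).subst g))
      (fun _ _ => Nat.zero_le _) (Finset.mem_univ i)
    omega

end Terms

/-! ### Models of the free equality axioms -/

section Models

variable {J : Type w} [(fnPart L).Structure J]

/-- The valuation listing the entries of `a` and then those of `b`. -/
def listing (d : J) {n m : ℕ} (a : Fin n → J) (b : Fin m → J) (k : ℕ) : J :=
  if h : k < n then a ⟨k, h⟩ else if h' : k - n < m then b ⟨k - n, h'⟩ else d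

theorem listing_left (d : J) {n m : ℕ} (a : Fin n → J) (b : Fin m → J) (i : Fin n) :
    listing d a b i = a i := by
  simp [listing]

theorem listing_right (d : J) {n m : ℕ} (a : Fin n → J) (b : Fin m → J) (i : Fin m) :
    listing d a b (n + i) = b i := by
  simp [listing]

theorem IsModelFEA.injective (hJ : IsModelFEA L J) {n : ℕ} (f : L.Functions n) {a b : Fin n → J}
    (H : funMap (L := fnPart L) f a = funMap (L := fnPart L) f b) : a = b := by
  -- The axiom uses the variables 0, …, n - 1 and n, …, 2n - 1, to which `listing` assigns `a` and
  -- `b`; the default value plays no role.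
  have := hJ _ (FEA.inj f) (listing (funMap (L := fnPart L) f a) a b)
  replace this := FirstOrder.Language.BoundedFormula.realize_iff.1 this
  rw [FirstOrder.Language.BoundedFormula.realize_iInf] at this
  have h2 := this.1
  change FirstOrder.Language.Formula.Realize _ _ → ∀ i, FirstOrder.Language.Formula.Realize _ _ at h2
  simp only [FirstOrder.Language.Formula.realize_equal, Term.realize_func, Term.realize_var,
    listing_left, listing_right] at h2
  exact funext (h2 H)

theorem IsModelFEA.clash (hJ : IsModelFEA L J) {n m : ℕ} (f : L.Functions n) (g : L.Functions m)
    (hfg : (⟨n, f⟩ : Σ k, L.Functions k) ≠ ⟨m, g⟩) (a : Fin n → J) (b : Fin m → J) :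
    funMap (L := fnPart L) f a ≠ funMap (L := fnPart L) g b := by
  intro H
  have := hJ _ (FEA.clash f g hfg) (listing (funMap (L := fnPart L) f a) a b)
  replace this := FirstOrder.Language.BoundedFormula.realize_iff.1 this
  have h2 := this.1
  change FirstOrder.Language.Formula.Realize _ _ → False at h2
  simp only [FirstOrder.Language.Formula.realize_equal, Term.realize_func, Term.realize_var,
    listing_left, listing_right] at h2
  exact h2 H

theorem IsModelFEA.occurs (hJ : IsModelFEA L J) {x : ℕ} {t : Tm L} (hne : t ≠ Term.var x)
    (hx : x ∈ t.varFinset) (h : ℕ → J) : h x ≠ t.realize h := by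
  intro H
  have := hJ _ (FEA.occurs x t hne hx) h
  replace this := FirstOrder.Language.BoundedFormula.realize_iff.1 this
  have h2 := this.1
  change FirstOrder.Language.Formula.Realize _ _ → False at h2
  simp only [FirstOrder.Language.Formula.realize_equal, Term.realize_var] at h2
  exact h2 H

theorem isModelFEA_of (h1 : ∀ {n : ℕ} (f : L.Functions n) (a b : Fin n → J),
      funMap (L := fnPart L) f a = funMap (L := fnPart L) f b → a = b)
    (h2 : ∀ {n m : ℕ} (f : L.Functions n) (g : L.Functions m),
      (⟨n, f⟩ : Σ k, L.Functions k) ≠ ⟨m, g⟩ → ∀ (a : Fin n → J) (b : Fin m → J),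
      funMap (L := fnPart L) f a ≠ funMap (L := fnPart L) g b)
    (h3 : ∀ (x : ℕ) (t : Tm L), t ≠ Term.var x → x ∈ t.varFinset → ∀ h : ℕ → J,
      h x ≠ t.realize h) : IsModelFEA L J := by
  intro φ hφ h
  cases hφ with
  | inj f =>
    refine FirstOrder.Language.BoundedFormula.realize_iff.2 ?_
    rw [FirstOrder.Language.BoundedFormula.realize_iInf]
    change FirstOrder.Language.Formula.Realize _ _ ↔ ∀ i, FirstOrder.Language.Formula.Realize _ _
    simp only [FirstOrder.Language.Formula.realize_equal, Term.realize_func, Term.realize_var]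
    exact ⟨fun H => congrFun (h1 f _ _ H), fun H => congrArg _ (funext H)⟩
  | clash f g hfg =>
    refine FirstOrder.Language.BoundedFormula.realize_iff.2 ?_
    change FirstOrder.Language.Formula.Realize _ _ ↔ False
    simp only [FirstOrder.Language.Formula.realize_equal, Term.realize_func, Term.realize_var]
    exact ⟨h2 f g hfg _ _, False.elim⟩
  | occurs x t hne hx =>
    refine FirstOrder.Language.BoundedFormula.realize_iff.2 ?_
    change FirstOrder.Language.Formula.Realize _ _ ↔ False
    simp only [FirstOrder.Language.Formula.realize_equal, Term.realize_var]
    exact ⟨h3 x t hne hx h, False.elim⟩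

theorem isModelFEA_term : IsModelFEA L (Tm L) := by
  refine isModelFEA_of ?_ ?_ ?_
  · intro n f a b H
    change Term.func (L := fnPart L) f a = Term.func (L := fnPart L) f b at H
    simpa using H
  · intro n m f g hfg a b H
    change Term.func (L := fnPart L) f a = Term.func (L := fnPart L) g b at H
    obtain ⟨rfl, H1, -⟩ := Term.func.inj H
    exact hfg (by rw [eq_of_heq H1])
  · intro x t hne hx h
    rw [realize_eq_subst]
    exact subst_ne_of_mem hne hx h

/-- The lift of the model of terms provides a non-trivial model in each universe over which `Le` may
quantify. -/
theorem exists_isModelFEA_nontrivial (L : FirstOrder.Language.{u, v}) :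
    ∃ (J : Type max u w') (_ : (fnPart L).Structure J), Nontrivial J ∧ IsModelFEA L J := by
  let S : (fnPart L).Structure (ULift.{w'} (Tm L)) :=
    { funMap := fun f ts => ⟨Term.func f fun i => (ts i).down⟩
      RelMap := fun r => r.elim }
  have hr : ∀ (t : Tm L) (h : ℕ → ULift.{w'} (Tm L)),
      (t.realize h).down = t.realize fun x => (h x).down := by
    intro t h
    induction t with
    | var x => rfl
    | func f ts ih =>
      simp only [Term.realize_func]
      change Term.func f _ = Term.func f _
      congr 1
      exact funext ih
  refine ⟨ULift.{w'} (Tm L), S, ⟨⟨Term.var 0⟩, ⟨Term.var 1⟩, by simp⟩, isModelFEA_of ?_ ?_ ?_⟩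
  · intro n f a b H
    have := isModelFEA_term.injective f (congrArg ULift.down H)
    funext i
    exact ULift.ext _ _ (congrFun this i)
  · intro n m f g hfg a b H
    exact isModelFEA_term.clash f g hfg _ _ (congrArg ULift.down H)
  · intro x t hne hx h H
    have := congrArg ULift.down H
    rw [hr] at this
    exact isModelFEA_term.occurs hne hx (fun x => (h x).down) this

end Models

/-! ### Unification -/

section Unification

/-- The equations that follow from `E` by the laws of equality and the injectivity of the function
symbols. -/
inductive Entails (E : List (Tm L × Tm L)) : Tm L → Tm L → Prop
  | base {s t : Tm L} : (s, t) ∈ E → Entails E s t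
  | refl (t : Tm L) : Entails E t t
  | symm {s t : Tm L} : Entails E s t → Entails E t s
  | trans {s t r : Tm L} : Entails E s t → Entails E t r → Entails E s r
  | congr {n : ℕ} (f : L.Functions n) {a b : Fin n → Tm L} : (∀ i, Entails E (a i) (b i)) →
      Entails E (Term.func (L := fnPart L) f a) (Term.func (L := fnPart L) f b)
  | inj {n : ℕ} {f : L.Functions n} {a b : Fin n → Tm L} :
      Entails E (Term.func (L := fnPart L) f a) (Term.func (L := fnPart L) f b) →
      ∀ i, Entails E (a i) (b i)

/-- Among the axioms only injectivity is needed for soundness. Applied to x = θ(x) for a most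
general unifier θ, this says that every solution in every model factors through θ. -/
theorem Entails.realize_eq {J : Type w} [(fnPart L).Structure J] (hJ : IsModelFEA L J)
    {E : List (Tm L × Tm L)} {h : ℕ → J} (hE : ∀ e ∈ E, e.1.realize h = e.2.realize h)
    {s t : Tm L} (H : Entails E s t) : s.realize h = t.realize h := by
  induction H with
  | base hm => exact hE _ hm
  | refl => rfl
  | symm _ ih => exact ih.symm
  | trans _ _ ih1 ih2 => exact ih1.trans ih2
  | congr f _ ih =>
    simp only [Term.realize_func]
    exact congrArg _ (funext ih)
  | inj _ i ih =>
    simp only [Term.realize_func] at ih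
    exact congrFun (hJ.injective _ ih) i

theorem Entails.mono {E F : List (Tm L × Tm L)} (hEF : ∀ e ∈ E, Entails F e.1 e.2) {s t : Tm L}
    (H : Entails E s t) : Entails F s t := by
  induction H with
  | base hm => exact hEF _ hm
  | refl => exact .refl _
  | symm _ ih => exact ih.symm
  | trans _ _ ih1 ih2 => exact ih1.trans ih2
  | congr f _ ih => exact .congr f ih
  | inj _ i ih => exact .inj ih i

theorem Entails.subst {E : List (Tm L × Tm L)} {θ : ℕ → Tm L}
    (H : ∀ x, Entails E (Term.var x) (θ x)) (t : Tm L) : Entails E t (t.subst θ) := by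
  induction t with
  | var x => exact H x
  | func f ts ih => exact .congr (L := L) f ih

/-- `E` entails an equation that fails in all models of the free equality axioms. -/
def Contradictory (E : List (Tm L × Tm L)) : Prop :=
  (∃ (n m : ℕ) (f : L.Functions n) (g : L.Functions m) (a : Fin n → Tm L) (b : Fin m → Tm L),
    (⟨n, f⟩ : Σ k, L.Functions k) ≠ ⟨m, g⟩ ∧
      Entails E (Term.func (L := fnPart L) f a) (Term.func (L := fnPart L) g b)) ∨
  ∃ (x : ℕ) (t : Tm L), t ≠ Term.var x ∧ x ∈ t.varFinset ∧ Entails E (Term.var x) t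

/-- `θ` is a most general unifier of `E`. -/
def IsMgu (E : List (Tm L × Tm L)) (θ : ℕ → Tm L) : Prop :=
  (∀ e ∈ E, e.1.subst θ = e.2.subst θ) ∧ ∀ x, Entails E (Term.var x) (θ x)

theorem Contradictory.mono {E F : List (Tm L × Tm L)} (hEF : ∀ e ∈ E, Entails F e.1 e.2)
    (H : Contradictory E) : Contradictory F := by
  obtain ⟨n, m, f, g, a, b, hfg, h⟩ | ⟨x, t, hne, hx, h⟩ := H
  · exact .inl ⟨n, m, f, g, a, b, hfg, h.mono hEF⟩
  · exact .inr ⟨x, t, hne, hx, h.mono hEF⟩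

theorem Contradictory.not_realize {J : Type w} [(fnPart L).Structure J] (hJ : IsModelFEA L J)
    {E : List (Tm L × Tm L)} (H : Contradictory E) (h : ℕ → J) :
    ¬ ∀ e ∈ E, e.1.realize h = e.2.realize h := by
  intro hE
  obtain ⟨n, m, f, g, a, b, hfg, H⟩ | ⟨x, t, hne, hx, H⟩ := H
  · have := H.realize_eq hJ hE
    simp only [Term.realize_func] at this
    exact hJ.clash f g hfg _ _ this
  · exact hJ.occurs hne hx h (H.realize_eq hJ hE)

/-- The total number of symbols of a list of equations. -/
def eqsSize (E : List (Tm L × Tm L)) : ℕ :=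
  (E.map fun e => termSize e.1 + termSize e.2).sum

theorem entails_of_cons {e : Tm L × Tm L} {E : List (Tm L × Tm L)} :
    ∀ e' ∈ E, Entails (e :: E) e'.1 e'.2 := fun _ he => .base (List.mem_cons_of_mem _ he)

theorem exists_mgu_swap {s t : Tm L} {E : List (Tm L × Tm L)}
    (H : (∃ θ, IsMgu ((s, t) :: E) θ) ∨ Contradictory ((s, t) :: E)) :
    (∃ θ, IsMgu ((t, s) :: E) θ) ∨ Contradictory ((t, s) :: E) := by
  have key : ∀ e ∈ (s, t) :: E, Entails ((t, s) :: E) e.1 e.2 := by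
    intro e he
    obtain rfl | he := List.mem_cons.1 he
    · exact (Entails.base List.mem_cons_self).symm
    · exact entails_of_cons e he
  obtain ⟨θ, h1, h2⟩ | H := H
  · refine .inl ⟨θ, ?_, fun x => (h2 x).mono key⟩
    intro e he
    obtain rfl | he := List.mem_cons.1 he
    · exact (h1 (s, t) List.mem_cons_self).symm
    · exact h1 e (List.mem_cons_of_mem _ he)
  · exact .inr (H.mono key)

/-- Elimination of a variable that does not occur on the other side of its equation. -/
theorem exists_mgu_elim {x : ℕ} {t : Tm L} (hx : x ∉ t.varFinset) {E : List (Tm L × Tm L)}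
    (H : ∀ σ : ℕ → Tm L, σ = Function.update Term.var x t →
      (∃ θ, IsMgu (E.map fun e => (e.1.subst σ, e.2.subst σ)) θ) ∨
      Contradictory (E.map fun e => (e.1.subst σ, e.2.subst σ))) :
    (∃ θ, IsMgu ((Term.var x, t) :: E) θ) ∨ Contradictory ((Term.var x, t) :: E) := by
  obtain ⟨σ, hσ⟩ : ∃ σ : ℕ → Tm L, σ = Function.update Term.var x t := ⟨_, rfl⟩
  have hσt : t.subst σ = t := subst_eq_self fun y hy => by
    have hyx : y ≠ x := fun h => hx (h ▸ hy)
    rw [hσ, Function.update_of_ne hyx]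
  have hs : ∀ r : Tm L, Entails ((Term.var x, t) :: E) r (r.subst σ) := by
    refine Entails.subst fun y => ?_
    by_cases hy : y = x
    · subst hy
      rw [hσ, Function.update_self]
      exact .base List.mem_cons_self
    · rw [hσ, Function.update_of_ne hy]
      exact .refl _
  have key : ∀ e ∈ E.map fun e => (e.1.subst σ, e.2.subst σ),
      Entails ((Term.var x, t) :: E) e.1 e.2 := by
    intro e he
    obtain ⟨e', he', rfl⟩ := List.mem_map.1 he
    exact (hs e'.1).symm.trans ((entails_of_cons e' he').trans (hs e'.2))
  obtain ⟨θ, h1, h2⟩ | H := H σ hσ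
  · refine .inl ⟨fun y => (σ y).subst θ, ?_, ?_⟩
    · intro e he
      rw [← subst_subst, ← subst_subst]
      obtain rfl | he := List.mem_cons.1 he
      · change ((σ x).subst θ) = _
        rw [hσt, hσ, Function.update_self]
      · exact h1 _ (List.mem_map_of_mem he)
    · intro y
      exact (hs (Term.var y)).trans (Entails.subst (fun z => (h2 z).mono key) _)
  · exact .inr (H.mono key)

/-- Termination is lexicographic. Eliminating a variable may enlarge the equations but leaves them
in a smaller set `V`; dropping a trivial equation or decomposing f(a) = f(b) keeps `V` and lowers
the number of symbols. -/
theorem exists_mgu_of_subset (V : Finset ℕ) : ∀ (E : List (Tm L × Tm L)),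
    (∀ e ∈ E, e.1.varFinset ⊆ V ∧ e.2.varFinset ⊆ V) → (∃ θ, IsMgu E θ) ∨ Contradictory E := by
  induction V using Finset.strongInduction with
  | H V IH =>
  suffices ∀ (m : ℕ) (E : List (Tm L × Tm L)), eqsSize E = m →
      (∀ e ∈ E, e.1.varFinset ⊆ V ∧ e.2.varFinset ⊆ V) → (∃ θ, IsMgu E θ) ∨ Contradictory E from
    fun E => this _ E rfl
  intro m
  induction m using Nat.strong_induction_on with
  | _ m IHm =>
  intro E hm hV
  have elim : ∀ (x : ℕ) (t : Tm L) (E : List (Tm L × Tm L)), Term.var x ≠ t →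
      (∀ e ∈ (Term.var x, t) :: E, e.1.varFinset ⊆ V ∧ e.2.varFinset ⊆ V) →
      (∃ θ, IsMgu ((Term.var x, t) :: E) θ) ∨ Contradictory ((Term.var x, t) :: E) := by
    intro x t E hne hV
    by_cases hx : x ∈ t.varFinset
    · exact .inr (.inr ⟨x, t, hne.symm, hx, .base List.mem_cons_self⟩)
    refine exists_mgu_elim hx fun σ hσ => ?_
    obtain ⟨hV1, hV2⟩ := hV _ List.mem_cons_self
    have hxV : x ∈ V := hV1 (by simp)
    have hsub : ∀ r : Tm L, r.varFinset ⊆ V → (r.subst σ).varFinset ⊆ V.erase x := by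
      intro r hr y hy
      obtain ⟨z, hz, hyz⟩ := mem_varFinset_subst.1 hy
      by_cases h : z = x
      · subst h
        rw [hσ, Function.update_self] at hyz
        exact Finset.mem_erase.2 ⟨fun h => hx (h ▸ hyz), hV2 hyz⟩
      · rw [hσ, Function.update_of_ne h] at hyz
        obtain rfl : y = z := by simpa using hyz
        exact Finset.mem_erase.2 ⟨h, hr hz⟩
    refine IH _ (Finset.erase_ssubset hxV) _ fun e he => ?_
    obtain ⟨e', he', rfl⟩ := List.mem_map.1 he
    obtain ⟨h1, h2⟩ := hV e' (List.mem_cons_of_mem _ he')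
    exact ⟨hsub _ h1, hsub _ h2⟩
  match E, hm, hV with
  | [], _, _ => exact .inl ⟨Term.var, by simp, fun x => .refl _⟩
  | (Term.var x, t) :: E, hm, hV =>
    by_cases hxt : Term.var x = t
    · subst hxt
      have hlt : eqsSize E < m := by
        rw [← hm]
        simp [eqsSize, termSize]
      obtain ⟨θ, h1, h2⟩ | H := IHm _ hlt E rfl fun e he => hV e (List.mem_cons_of_mem _ he)
      · refine .inl ⟨θ, ?_, fun x => (h2 x).mono entails_of_cons⟩
        intro e he
        obtain rfl | he := List.mem_cons.1 he
        · rfl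
        · exact h1 e he
      · exact .inr (H.mono entails_of_cons)
    · exact elim x t E hxt hV
  | (Term.func f a, Term.var x) :: E, hm, hV =>
    refine exists_mgu_swap (elim x _ E (by simp) ?_)
    intro e he
    obtain rfl | he := List.mem_cons.1 he
    · exact (hV _ List.mem_cons_self).symm
    · exact hV e (List.mem_cons_of_mem _ he)
  | (Term.func (l := n) f a, Term.func (l := k) g b) :: E, hm, hV =>
    by_cases hfg : (⟨n, f⟩ : Σ k, L.Functions k) = ⟨k, g⟩
    · obtain ⟨rfl, hfg⟩ := Sigma.mk.inj hfg
      obtain rfl := eq_of_heq hfg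
      have hlt : eqsSize (List.ofFn (fun i => (a i, b i)) ++ E) < m := by
        rw [← hm]
        simp only [eqsSize, List.map_append, List.map_ofFn, List.sum_append, List.map_cons,
          List.sum_cons, List.sum_ofFn, termSize, Function.comp_def, Finset.sum_add_distrib]
        omega
      obtain ⟨hV1, hV2⟩ := hV _ List.mem_cons_self
      have key : ∀ e ∈ List.ofFn (fun i => (a i, b i)) ++ E,
          Entails ((Term.func f a, Term.func f b) :: E) e.1 e.2 := by
        intro e he
        obtain he | he := List.mem_append.1 he
        · obtain ⟨i, rfl⟩ := List.mem_ofFn.1 he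
          exact Entails.inj (L := L) (.base List.mem_cons_self) i
        · exact entails_of_cons e he
      have hVs : ∀ e ∈ List.ofFn (fun i => (a i, b i)) ++ E,
          e.1.varFinset ⊆ V ∧ e.2.varFinset ⊆ V := by
        intro e he
        obtain he | he := List.mem_append.1 he
        · obtain ⟨i, rfl⟩ := List.mem_ofFn.1 he
          exact ⟨fun y hy => hV1 (by simpa using ⟨i, hy⟩), fun y hy => hV2 (by simpa using ⟨i, hy⟩)⟩
        · exact hV e (List.mem_cons_of_mem _ he)
      obtain ⟨θ, h1, h2⟩ | H := IHm _ hlt _ rfl hVs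
      · refine .inl ⟨θ, ?_, fun x => (h2 x).mono key⟩
        intro e he
        obtain rfl | he := List.mem_cons.1 he
        · simp only [Term.subst]
          congr 1
          funext i
          exact h1 (a i, b i) (List.mem_append_left _ (List.mem_ofFn.2 ⟨i, rfl⟩))
        · exact h1 e (List.mem_append_right _ he)
      · exact .inr (H.mono key)
    · exact .inr (.inl ⟨n, k, f, g, a, b, hfg, .base List.mem_cons_self⟩)

theorem exists_mgu (E : List (Tm L × Tm L)) : (∃ θ, IsMgu E θ) ∨ Contradictory E := by
  refine exists_mgu_of_subset
    ((E.map fun e => e.1.varFinset ∪ e.2.varFinset).foldr (· ∪ ·) ∅) E fun e he => ?_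
  have : ∀ F : List (Finset ℕ), ∀ V ∈ F, V ⊆ F.foldr (· ∪ ·) ∅ := by
    intro F V hV
    induction F with
    | nil => simp at hV
    | cons W F ih =>
      obtain rfl | hV := List.mem_cons.1 hV
      · exact Finset.subset_union_left
      · exact (ih hV).trans Finset.subset_union_right
  have h := this _ _ (List.mem_map_of_mem (f := fun e => e.1.varFinset ∪ e.2.varFinset) he)
  exact ⟨Finset.subset_union_left.trans h, Finset.subset_union_right.trans h⟩

/-- If every assignment to the variables in `P` extends to a solution of `E` in some non-trivial
model, then `E` is solvable by terms without binding the variables in `P`. -/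
theorem exists_generic_solution {J : Type w} [(fnPart L).Structure J] [Nontrivial J]
    (hc : Nonempty (L.Functions 0)) (hJ : IsModelFEA L J) (E : List (Tm L × Tm L)) (P : Set ℕ)
    (H : ∀ k : ℕ → J, ∃ m : ℕ → J, (∀ p ∈ P, m p = k p) ∧
      ∀ e ∈ E, e.1.realize m = e.2.realize m) :
    ∃ μ : ℕ → Tm L, (∀ p ∈ P, μ p = Term.var p) ∧ ∀ e ∈ E, e.1.subst μ = e.2.subst μ := by
  classical
  obtain ⟨c⟩ := hc
  obtain ⟨d₀, d₁, hd⟩ := exists_pair_ne J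
  obtain ⟨θ, h1, h2⟩ | hE := exists_mgu E
  swap
  · obtain ⟨m, -, hm⟩ := H fun _ => d₀
    exact absurd hm (hE.not_realize hJ m)
  have hk : ∀ k : ℕ → J, ∃ m : ℕ → J, ∀ p ∈ P, k p = (θ p).realize m := by
    intro k
    obtain ⟨m, hm, hE⟩ := H k
    refine ⟨m, fun p hp => ?_⟩
    rw [← hm p hp]
    exact (h2 p).realize_eq hJ hE
  have hvar : ∀ p ∈ P, ∃ y, θ p = Term.var y := by
    intro p hp
    cases hθ : θ p with
    | var y => exact ⟨y, rfl⟩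
    | func f ts =>
      exfalso
      rename_i n
      -- A value outside the range of `f`: if `f` is a constant, one of two distinct elements works;
      -- otherwise the value of the constant `c` does, by the clash axiom. A parameter bound to a
      -- term with head `f` could not take this value.
      have : ∃ d : J, ∀ a : Fin n → J, d ≠ funMap (L := fnPart L) f a := by
        cases n with
        | zero =>
          by_cases h : d₀ = funMap (L := fnPart L) f default
          · refine ⟨d₁, fun a ha => hd ?_⟩
            rw [h, ha, Subsingleton.elim a default]
          · refine ⟨d₀, fun a ha => h ?_⟩
            rw [ha, Subsingleton.elim a default]
        | succ n =>
          exact ⟨funMap (L := fnPart L) c default, fun a =>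
            hJ.clash (n := 0) (m := n + 1) c f (fun h => by simpa using congrArg Sigma.fst h) _ _⟩
      obtain ⟨d, hd⟩ := this
      obtain ⟨m, hm⟩ := hk fun _ => d
      have := hm p hp
      rw [hθ] at this
      exact hd _ this
  choose! r hr using hvar
  -- Parameters sent to the same variable would always have equal values, but `p` and `q` may be
  -- assigned `d₀` and `d₁`.
  have hinj : ∀ p ∈ P, ∀ q ∈ P, r p = r q → p = q := by
    intro p hp q hq h
    by_contra hpq
    obtain ⟨m, hm⟩ := hk fun x => if x = p then d₀ else d₁
    have h1 := hm p hp
    have h2 := hm q hq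
    rw [hr p hp, h, ← hr q hq, ← h2] at h1
    simp [Ne.symm hpq, hd] at h1
  -- Since `r` is injective on `P`, it can be undone after `θ`; the result still unifies and now
  -- fixes the parameters.
  refine ⟨fun x => (θ x).subst fun y => if h : ∃ p ∈ P, r p = y then Term.var h.choose
    else Term.var y, ?_, ?_⟩
  · intro p hp
    have h : ∃ q ∈ P, r q = r p := ⟨p, hp, rfl⟩
    simp only [hr p hp, Term.subst]
    rw [dif_pos h, hinj _ h.choose_spec.1 p hp h.choose_spec.2]
  · intro e he
    rw [← subst_subst, ← subst_subst, h1 e he]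

end Unification

end QueryLattice

namespace QueryLattice

open FirstOrder.Language FirstOrder.Language.Structure

variable {L : FirstOrder.Language.{u, v}}

/-! ### Equality of atoms as a system of equations -/

section Atoms

theorem GAtom.mem_vars {A : GAtom L (Tm L)} {x : ℕ} :
    x ∈ A.vars ↔ ∃ i, x ∈ (A.args i).varFinset := by
  simp [GAtom.vars]

theorem GAtom.map_map {X Y Z : Type*} (g : X → Y) (h : Y → Z) (A : GAtom L X) :
    (A.map g).map h = A.map fun x => h (g x) := rfl

theorem GAtom.map_realize_congr {J : Type w} [(fnPart L).Structure J] {A : GAtom L (Tm L)}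
    {g h : ℕ → J} (H : ∀ x ∈ A.vars, g x = h x) :
    (A.map fun t => t.realize g) = A.map fun t => t.realize h := by
  simp only [GAtom.map, GAtom.mk.injEq, heq_eq_eq, true_and]
  funext i
  exact realize_congr_vars fun x hx => H x (GAtom.mem_vars.2 ⟨i, hx⟩)

/-- Equations between the corresponding arguments of two atoms. -/
def atomEqs (A B : GAtom L (Tm L)) : List (Tm L × Tm L) :=
  List.ofFn fun i : Fin A.arity =>
    -- The default gives a trivial equation. It is reached only when the arities differ, a case that
    -- `GAtom.map_eq_map_iff` rules out by comparing predicate symbols.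
    (A.args i, if h : (i : ℕ) < B.arity then B.args ⟨i, h⟩ else A.args i)

theorem GAtom.map_eq_map_iff {X : Type*} {A B : GAtom L (Tm L)} (h : Tm L → X) :
    A.map h = B.map h ↔ (⟨A.arity, A.rel⟩ : Σ n, L.Relations n) = ⟨B.arity, B.rel⟩ ∧
      ∀ e ∈ atomEqs A B, h e.1 = h e.2 := by
  obtain ⟨n, R, a⟩ := A
  obtain ⟨m, S, b⟩ := B
  constructor
  · intro H
    obtain ⟨rfl, H1, H2⟩ := GAtom.mk.inj H
    refine ⟨by rw [eq_of_heq H1], fun e he => ?_⟩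
    obtain ⟨i, rfl⟩ := List.mem_ofFn.1 he
    have := congrFun (eq_of_heq H2) i
    simpa using this
  · rintro ⟨H, H2⟩
    obtain ⟨rfl, H1⟩ := Sigma.mk.inj H
    obtain rfl := eq_of_heq H1
    simp only [GAtom.map, GAtom.mk.injEq, heq_eq_eq, true_and]
    funext i
    have := H2 _ (List.mem_ofFn.2 ⟨i, rfl⟩)
    simpa using this

end Atoms

/-! ### Satisfaction of quantified conjunctions -/

section Bodies

/-- The valuation `g` satisfies the equations, and satisfies each atom in the corresponding
component of the multiinterpretation. -/
def BodySat {J : Type w} [(fnPart L).Structure J] (E : List (Tm L × Tm L))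
    (As : List (GAtom L (Tm L))) (g : ℕ → J) (Is : List (Interp L J)) : Prop :=
  (∀ e ∈ E, e.1.realize g = e.2.realize g) ∧
    List.Forall₂ (fun A I => (A.map fun t => t.realize g) ∈ I) As Is

/-- The variable `x` occurs in one of the equations or atoms. -/
def BodyVar (E : List (Tm L × Tm L)) (As : List (GAtom L (Tm L))) (x : ℕ) : Prop :=
  (∃ e ∈ E, x ∈ e.1.varFinset ∨ x ∈ e.2.varFinset) ∨ ∃ A ∈ As, x ∈ A.vars

/-- Simultaneous substitution in equations. -/
def substEqs (σ : ℕ → Tm L) (E : List (Tm L × Tm L)) : List (Tm L × Tm L) :=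
  E.map fun e => (e.1.subst σ, e.2.subst σ)

/-- Simultaneous substitution in atoms. -/
def substAtoms (σ : ℕ → Tm L) (As : List (GAtom L (Tm L))) : List (GAtom L (Tm L)) :=
  As.map fun A => A.map fun t => t.subst σ

variable {J : Type w} [(fnPart L).Structure J]

theorem forall₂_congr_left {α β : Type*} {R S : α → β → Prop} {l : List α} {k : List β}
    (H : ∀ a ∈ l, ∀ b, R a b → S a b) (h : List.Forall₂ R l k) : List.Forall₂ S l k := by
  induction h with
  | nil => exact .nil
  | cons hab _ ih =>
    exact .cons (H _ List.mem_cons_self _ hab) (ih fun a ha => H a (List.mem_cons_of_mem _ ha))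

theorem BodySat.congr {E : List (Tm L × Tm L)} {As : List (GAtom L (Tm L))} {g h : ℕ → J}
    {Is : List (Interp L J)} (H : ∀ x, BodyVar E As x → g x = h x) (hg : BodySat E As g Is) :
    BodySat E As h Is := by
  refine ⟨fun e he => ?_, ?_⟩
  · rw [← realize_congr_vars fun x hx => H x (.inl ⟨e, he, .inl hx⟩),
      ← realize_congr_vars fun x hx => H x (.inl ⟨e, he, .inr hx⟩)]
    exact hg.1 e he
  · refine forall₂_congr_left (fun A hA I hI => ?_) hg.2
    rwa [← GAtom.map_realize_congr fun x hx => H x (.inr ⟨A, hA, hx⟩)]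

theorem bodySat_subst {E : List (Tm L × Tm L)} {As : List (GAtom L (Tm L))} {g : ℕ → J}
    {Is : List (Interp L J)} (σ : ℕ → Tm L) :
    BodySat (substEqs σ E) (substAtoms σ As) g Is ↔
      BodySat E As (fun x => (σ x).realize g) Is := by
  simp only [BodySat, substEqs, substAtoms, List.forall_mem_map, Term.realize_subst,
    List.forall₂_map_left_iff, GAtom.map_map]

theorem bodySat_append {E F : List (Tm L × Tm L)} {As Bs : List (GAtom L (Tm L))} {g : ℕ → J}
    {Is : List (Interp L J)} :
    BodySat (E ++ F) (As ++ Bs) g Is ↔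
      BodySat E As g (Is.take As.length) ∧ BodySat F Bs g (Is.drop As.length) := by
  constructor
  · rintro ⟨h1, h2⟩
    have h3 := List.forall₂_take As.length h2
    have h4 := List.forall₂_drop As.length h2
    rw [List.take_left] at h3
    rw [List.drop_left] at h4
    exact ⟨⟨fun e he => h1 e (List.mem_append_left _ he), h3⟩,
      ⟨fun e he => h1 e (List.mem_append_right _ he), h4⟩⟩
  · rintro ⟨⟨h1, h2⟩, h3, h4⟩
    refine ⟨fun e he => (List.mem_append.1 he).elim (h1 e) (h3 e), ?_⟩
    rw [← List.take_append_drop As.length Is]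
    exact List.rel_append h2 h4

theorem exists_lt_of_bodyVar (E : List (Tm L × Tm L)) (As : List (GAtom L (Tm L)))
    (zs : List ℕ) : ∃ b, (∀ z ∈ zs, z < b) ∧ ∀ x, BodyVar E As x → x < b := by
  have hf : {x | BodyVar E As x}.Finite := by
    have : {x | BodyVar E As x} =
        (⋃ e ∈ {e | e ∈ E}, ((e.1.varFinset ∪ e.2.varFinset : Finset ℕ) : Set ℕ)) ∪
          ⋃ A ∈ {A | A ∈ As}, (A.vars : Set ℕ) := by
      ext x
      simp [BodyVar]
    rw [this]
    exact ((List.finite_toSet E).biUnion fun e _ => Finset.finite_toSet _).union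
      ((List.finite_toSet As).biUnion fun e _ => Finset.finite_toSet _)
  obtain ⟨b, hb⟩ := (hf.union (List.finite_toSet zs)).bddAbove
  exact ⟨b + 1, fun z hz => Nat.lt_succ_of_le (hb (.inr hz)),
    fun x hx => Nat.lt_succ_of_le (hb (.inl hx))⟩

/-- The valuation `h` satisfies the equations and atoms for suitable values of the variables in
`zs`. -/
def ExSat (zs : List ℕ) (E : List (Tm L × Tm L)) (As : List (GAtom L (Tm L))) (h : ℕ → J)
    (Is : List (Interp L J)) : Prop :=
  ∃ g : ℕ → J, (∀ x, x ∉ zs → g x = h x) ∧ BodySat E As g Is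

/-- Neither block of bound variables meets the other body, so a common witness splits into two and
two witnesses can be glued. -/
theorem exSat_append {zs ws : List ℕ} {E F : List (Tm L × Tm L)} {As Bs : List (GAtom L (Tm L))}
    {h : ℕ → J} {Is : List (Interp L J)} (h1 : ∀ x, BodyVar E As x → x ∉ ws)
    (h2 : ∀ x, BodyVar F Bs x → x ∉ zs) :
    ExSat (zs ++ ws) (E ++ F) (As ++ Bs) h Is ↔
      ExSat zs E As h (Is.take As.length) ∧ ExSat ws F Bs h (Is.drop As.length) := by
  constructor
  · rintro ⟨g, hg, H⟩
    obtain ⟨H1, H2⟩ := bodySat_append.1 H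
    refine ⟨⟨fun x => if x ∈ zs then g x else h x, fun x hx => if_neg hx, H1.congr ?_⟩,
      ⟨fun x => if x ∈ ws then g x else h x, fun x hx => if_neg hx, H2.congr ?_⟩⟩
    · intro x hx
      split_ifs with hz
      · rfl
      · exact hg x (by simp [hz, h1 x hx])
    · intro x hx
      split_ifs with hz
      · rfl
      · exact hg x (by simp [hz, h2 x hx])
  · rintro ⟨⟨g1, hg1, H1⟩, g2, hg2, H2⟩
    refine ⟨fun x => if x ∈ zs then g1 x else g2 x, ?_, bodySat_append.2 ⟨H1.congr ?_, H2.congr ?_⟩⟩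
    · intro x hx
      simp only [List.mem_append, not_or] at hx
      simp only [hx.1, if_false]
      exact hg2 x hx.2
    · intro x hx
      split_ifs with hz
      · rfl
      · rw [hg1 x hz, hg2 x (h1 x hx)]
    · intro x hx
      rw [if_neg (h2 x hx)]

/-- The renaming of the variables `z` in `zs` to `ρ z`. -/
def rename (ρ : ℕ → ℕ) (zs : List ℕ) : ℕ → Tm L :=
  fun x => Term.var (if x ∈ zs then ρ x else x)

/-- Injectivity of `ρ` on the bound variables lets a witness be moved along `ρ` and back; freshness
keeps the new bound variables from capturing those of the body. -/
theorem exSat_rename {ρ : ℕ → ℕ} {zs : List ℕ} {E : List (Tm L × Tm L)}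
    {As : List (GAtom L (Tm L))} (hinj : ∀ x ∈ zs, ∀ y ∈ zs, ρ x = ρ y → x = y)
    (hfresh : ∀ x, BodyVar E As x → x ∉ zs.map ρ) {h : ℕ → J} {Is : List (Interp L J)} :
    ExSat (zs.map ρ) (substEqs (rename ρ zs) E) (substAtoms (rename ρ zs) As) h Is ↔
      ExSat zs E As h Is := by
  classical
  constructor
  · rintro ⟨g, hg, H⟩
    rw [bodySat_subst] at H
    refine ⟨fun x => if x ∈ zs then g (ρ x) else h x, fun x hx => if_neg hx, H.congr ?_⟩
    intro x hx
    simp only [rename, Term.realize_var]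
    split_ifs with hz
    · rfl
    · exact hg x (hfresh x hx)
  · rintro ⟨g, hg, H⟩
    refine ⟨fun x => if hx : ∃ z ∈ zs, ρ z = x then g hx.choose else h x, ?_, ?_⟩
    · intro x hx
      exact dif_neg fun hx' => hx (List.mem_map.2 hx')
    · rw [bodySat_subst]
      refine H.congr fun x hx => ?_
      simp only [rename, Term.realize_var]
      split_ifs with hz h1 h1
      · rw [hinj _ h1.choose_spec.1 _ hz h1.choose_spec.2]
      · exact absurd ⟨x, hz, rfl⟩ h1
      · exact absurd (List.mem_map.2 h1) (hfresh x hx)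
      · exact hg x hz

theorem bodyVar_subst {E : List (Tm L × Tm L)} {As : List (GAtom L (Tm L))} {σ : ℕ → Tm L}
    {y : ℕ} : BodyVar (substEqs σ E) (substAtoms σ As) y ↔
      ∃ x, BodyVar E As x ∧ y ∈ (σ x).varFinset := by
  constructor
  · rintro (⟨e', he', hy⟩ | ⟨A', hA', hy⟩)
    · obtain ⟨e, he, rfl⟩ := List.mem_map.1 he'
      obtain hy | hy := hy
      · obtain ⟨x, hx, hy⟩ := mem_varFinset_subst.1 hy
        exact ⟨x, .inl ⟨e, he, .inl hx⟩, hy⟩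
      · obtain ⟨x, hx, hy⟩ := mem_varFinset_subst.1 hy
        exact ⟨x, .inl ⟨e, he, .inr hx⟩, hy⟩
    · obtain ⟨A, hA, rfl⟩ := List.mem_map.1 hA'
      obtain ⟨i, hy⟩ := GAtom.mem_vars.1 hy
      obtain ⟨x, hx, hy⟩ := mem_varFinset_subst.1 hy
      exact ⟨x, .inr ⟨A, hA, GAtom.mem_vars.2 ⟨i, hx⟩⟩, hy⟩
  · rintro ⟨x, ⟨e, he, hx | hx⟩ | ⟨A, hA, hx⟩, hy⟩
    · exact .inl ⟨_, List.mem_map_of_mem he, .inl (mem_varFinset_subst.2 ⟨x, hx, hy⟩)⟩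
    · exact .inl ⟨_, List.mem_map_of_mem he, .inr (mem_varFinset_subst.2 ⟨x, hx, hy⟩)⟩
    · obtain ⟨i, hx⟩ := GAtom.mem_vars.1 hx
      exact .inr ⟨_, List.mem_map_of_mem hA,
        GAtom.mem_vars.2 ⟨i, mem_varFinset_subst.2 ⟨x, hx, hy⟩⟩⟩

theorem bodyVar_rename {ρ : ℕ → ℕ} {zs : List ℕ} {E : List (Tm L × Tm L)}
    {As : List (GAtom L (Tm L))} {y : ℕ}
    (hy : BodyVar (substEqs (rename ρ zs) E) (substAtoms (rename ρ zs) As) y) :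
    y ∈ zs.map ρ ∨ (BodyVar E As y ∧ y ∉ zs) := by
  obtain ⟨x, hx, hyx⟩ := bodyVar_subst.1 hy
  simp only [rename, Term.varFinset, Finset.mem_singleton] at hyx
  split_ifs at hyx with hz
  · exact .inl (List.mem_map.2 ⟨x, hz, hyx.symm⟩)
  · exact .inr (hyx ▸ ⟨hx, hz⟩)

end Bodies

/-! ### Prenex forms and preservation of solutions -/

section NormalForms

/-- A prenex form of a query: bound variables, equations and atoms, together with a proposition
that is false if the query contains `FALSE`. -/
structure NForm (L : FirstOrder.Language.{u, v}) where
  /-- the query does not contain `FALSE` -/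
  ok : Prop
  /-- the bound variables -/
  zs : List ℕ
  /-- the equations -/
  eqs : List (Tm L × Tm L)
  /-- the atoms -/
  atoms : List (GAtom L (Tm L))

/-- An upper bound for the variables of a prenex form. -/
noncomputable def NForm.bound (n : NForm L) : ℕ :=
  (exists_lt_of_bodyVar n.eqs n.atoms n.zs).choose

theorem NForm.lt_bound_of_mem (n : NForm L) : ∀ z ∈ n.zs, z < n.bound :=
  (exists_lt_of_bodyVar n.eqs n.atoms n.zs).choose_spec.1

theorem NForm.lt_bound (n : NForm L) : ∀ x, BodyVar n.eqs n.atoms x → x < n.bound :=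
  (exists_lt_of_bodyVar n.eqs n.atoms n.zs).choose_spec.2

/-- The prenex form in which each bound variable `z` is renamed to `z + k`. -/
def NForm.shift (n : NForm L) (k : ℕ) : NForm L where
  ok := n.ok
  zs := n.zs.map (· + k)
  eqs := substEqs (rename (· + k) n.zs) n.eqs
  atoms := substAtoms (rename (· + k) n.zs) n.atoms

/-- The solutions of a prenex form. -/
def NForm.Sat {J : Type w} [(fnPart L).Structure J] (n : NForm L) (h : ℕ → J)
    (Is : List (Interp L J)) : Prop :=
  n.ok ∧ ExSat n.zs n.eqs n.atoms h Is

theorem NForm.le_of_mem_shift {n : NForm L} {k : ℕ} : ∀ z ∈ (n.shift k).zs, k ≤ z := by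
  intro z hz
  obtain ⟨y, -, rfl⟩ := List.mem_map.1 hz
  exact Nat.le_add_left _ _

theorem NForm.sat_shift {J : Type w} [(fnPart L).Structure J] (n : NForm L) {k : ℕ}
    (hk : n.bound ≤ k) (h : ℕ → J) (Is : List (Interp L J)) :
    (n.shift k).Sat h Is ↔ n.Sat h Is := by
  refine and_congr_right fun _ => exSat_rename (fun x _ y _ h => Nat.add_right_cancel h) ?_
  intro x hx hz
  have h1 := n.lt_bound x hx
  have h2 := n.le_of_mem_shift x hz
  omega

/-- The prenex form of a conjunction of prenex forms. -/
noncomputable def NForm.and (m n : NForm L) : NForm L :=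
  -- The bound variables of `m'` lie above all variables of `n`, and then those of `n'` lie above
  -- all variables of `m'`; this gives both freshness conditions of `exSat_append`.
  let m' := m.shift (max m.bound n.bound)
  let n' := n.shift (max n.bound m'.bound)
  ⟨m.ok ∧ n.ok, m'.zs ++ n'.zs, m'.eqs ++ n'.eqs, m'.atoms ++ n'.atoms⟩

theorem NForm.sat_and {J : Type w} [(fnPart L).Structure J] (m n : NForm L) (h : ℕ → J)
    (Is : List (Interp L J)) :
    (m.and n).Sat h Is ↔
      m.Sat h (Is.take m.atoms.length) ∧ n.Sat h (Is.drop m.atoms.length) := by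
  rw [← m.sat_shift (le_max_left m.bound n.bound),
    ← n.sat_shift (le_max_left n.bound (m.shift (max m.bound n.bound)).bound)]
  simp only [NForm.and, NForm.Sat]
  rw [exSat_append]
  · simp only [NForm.shift, substAtoms, List.length_map]
    tauto
  · intro x hx hz
    have h1 := NForm.lt_bound _ x hx
    have h2 := NForm.le_of_mem_shift x hz
    omega
  · intro x hx hz
    have h2 := NForm.le_of_mem_shift x hz
    obtain hx | ⟨hx, -⟩ := bodyVar_rename hx
    · have h3 := NForm.le_of_mem_shift (n := n) x hx
      have h4 := NForm.lt_bound_of_mem _ x hz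
      omega
    · have h3 := n.lt_bound x hx
      omega

namespace Query

/-- A prenex form of a query. -/
noncomputable def nform : Query L → NForm L
  | tru => ⟨True, [], [], []⟩
  | fls => ⟨False, [], [], []⟩
  | eq s t => ⟨True, [], [(s, t)], []⟩
  | atom A => ⟨True, [], [], [A]⟩
  | and Q₁ Q₂ => Q₁.nform.and Q₂.nform
  | ex x Q => ⟨Q.nform.ok, x :: Q.nform.zs, Q.nform.eqs, Q.nform.atoms⟩

theorem length_atoms_nform (Q : Query L) : Q.nform.atoms.length = Q.card := by
  induction Q with
  | tru => rfl
  | fls => rfl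
  | eq s t => rfl
  | atom A => rfl
  | and Q₁ Q₂ ih₁ ih₂ => simp [nform, NForm.and, NForm.shift, substAtoms, card, ih₁, ih₂]
  | ex x Q ih => exact ih

variable {J : Type w} [(fnPart L).Structure J]

theorem exSat_nil {E : List (Tm L × Tm L)} {As : List (GAtom L (Tm L))} {h : ℕ → J}
    {Is : List (Interp L J)} : ExSat [] E As h Is ↔ BodySat E As h Is := by
  constructor
  · rintro ⟨g, hg, H⟩
    exact H.congr fun x _ => hg x (by simp)
  · exact fun H => ⟨h, fun _ _ => rfl, H⟩

theorem exSat_cons {x : ℕ} {zs : List ℕ} {E : List (Tm L × Tm L)} {As : List (GAtom L (Tm L))}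
    {h : ℕ → J} {Is : List (Interp L J)} :
    ExSat (x :: zs) E As h Is ↔ ∃ d, ExSat zs E As (Function.update h x d) Is := by
  constructor
  · rintro ⟨g, hg, H⟩
    refine ⟨g x, g, fun y hy => ?_, H⟩
    by_cases hyx : y = x
    · subst hyx
      simp
    · rw [Function.update_of_ne hyx]
      exact hg y (by simp [hyx, hy])
  · rintro ⟨d, g, hg, H⟩
    refine ⟨g, fun y hy => ?_, H⟩
    simp only [List.mem_cons, not_or] at hy
    rw [hg y hy.2, Function.update_of_ne hy.1]

theorem mem_sol_iff_nform {Q : Query L} : ∀ {h : ℕ → J} {Is : List (Interp L J)},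
    Is.length = Q.card → (h ∈ Q.sol J Is ↔ Q.nform.Sat h Is) := by
  induction Q with
  | tru =>
    intro h Is hI
    obtain rfl : Is = [] := List.length_eq_zero_iff.1 hI
    simp [sol, nform, NForm.Sat, exSat_nil, BodySat]
  | fls =>
    intro h Is hI
    simp [sol, nform, NForm.Sat]
  | eq s t =>
    intro h Is hI
    obtain rfl : Is = [] := List.length_eq_zero_iff.1 hI
    simp [sol, nform, NForm.Sat, exSat_nil, BodySat]
  | atom A =>
    intro h Is hI
    obtain ⟨I, rfl⟩ := List.length_eq_one_iff.1 hI
    simp [sol, nform, NForm.Sat, exSat_nil, BodySat]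
  | and Q₁ Q₂ ih₁ ih₂ =>
    intro h Is hI
    simp only [card] at hI
    simp only [sol, nform, NForm.sat_and, length_atoms_nform, Set.mem_inter_iff]
    rw [ih₁ (by simp; omega), ih₂ (by simp; omega)]
  | ex x Q ih =>
    intro h Is hI
    simp only [sol, nform, NForm.Sat, exSat_cons, Set.mem_ofPred_eq]
    constructor
    · rintro ⟨d, hd⟩
      exact ⟨((ih hI).1 hd).1, d, ((ih hI).1 hd).2⟩
    · rintro ⟨h1, d, hd⟩
      exact ⟨d, (ih hI).2 ⟨h1, hd⟩⟩

theorem sol_congr {Q : Query L} : ∀ {g h : ℕ → J} {Is : List (Interp L J)},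
    (∀ x ∈ Q.freeVars, g x = h x) → g ∈ Q.sol J Is → h ∈ Q.sol J Is := by
  induction Q with
  | tru => exact fun _ _ => trivial
  | fls => exact fun _ h => h.elim
  | eq s t =>
    intro g h Is H hg
    simp only [sol, Set.mem_ofPred_eq] at hg ⊢
    rwa [← realize_congr_vars fun x hx => H x (Finset.mem_union_left _ hx),
      ← realize_congr_vars fun x hx => H x (Finset.mem_union_right _ hx)]
  | atom A =>
    rintro g h Is H ⟨I, rfl, hI⟩
    exact ⟨I, rfl, by rwa [← GAtom.map_realize_congr H]⟩
  | and Q₁ Q₂ ih₁ ih₂ =>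
    intro g h Is H hg
    exact ⟨ih₁ (fun x hx => H x (Finset.mem_union_left _ hx)) hg.1,
      ih₂ (fun x hx => H x (Finset.mem_union_right _ hx)) hg.2⟩
  | ex x Q ih =>
    rintro g h Is H ⟨d, hd⟩
    refine ⟨d, ih (fun y hy => ?_) hd⟩
    by_cases hyx : y = x
    · subst hyx
      simp
    · rw [Function.update_of_ne hyx, Function.update_of_ne hyx]
      exact H y (Finset.mem_erase.2 ⟨hyx, hy⟩)

/-- Queries are positive existential, so homomorphisms preserve their solutions, provided the
components are mapped into each other. -/
theorem sol_map {J' : Type w'} [(fnPart L).Structure J'] {φ : J → J'}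
    (hφ : ∀ (t : Tm L) (h : ℕ → J), φ (t.realize h) = t.realize fun x => φ (h x)) {Q : Query L} :
    ∀ {h : ℕ → J} {Is : List (Interp L J)} {Is' : List (Interp L J')},
    List.Forall₂ (fun I I' => ∀ A ∈ I, A.map φ ∈ I') Is Is' → h ∈ Q.sol J Is →
      (fun x => φ (h x)) ∈ Q.sol J' Is' := by
  induction Q with
  | tru => exact fun _ _ => trivial
  | fls => exact fun _ h => h.elim
  | eq s t =>
    intro h Is Is' H hg
    simp only [sol, Set.mem_ofPred_eq] at hg ⊢
    rw [← hφ, ← hφ, hg]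
  | atom A =>
    rintro h Is Is' H ⟨I, rfl, hI⟩
    cases H with
    | cons h1 h2 =>
      cases h2
      refine ⟨_, rfl, ?_⟩
      simp only [← hφ]
      exact h1 _ hI
  | and Q₁ Q₂ ih₁ ih₂ =>
    intro h Is Is' H hg
    exact ⟨ih₁ (List.forall₂_take _ H) hg.1, ih₂ (List.forall₂_drop _ H) hg.2⟩
  | ex x Q ih =>
    rintro h Is Is' H ⟨d, hd⟩
    refine ⟨φ d, ?_⟩
    have := ih H hd
    convert this using 1
    funext y
    by_cases hyx : y = x
    · subst hyx
      simp
    · rw [Function.update_of_ne hyx, Function.update_of_ne hyx]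

end Query

end NormalForms

/-! ### Transfer between models -/

section Transfer

/-- If all instances of a tuple of terms and atoms in a non-trivial model are solutions of `Q`,
then the tuple itself is a solution in the model of terms. -/
theorem Query.mem_sol_term_of_forall {J : Type w} [(fnPart L).Structure J] [Nontrivial J]
    (hc : Nonempty (L.Functions 0)) (hJ : IsModelFEA L J) {Q : Query L}
    {Bs : List (GAtom L (Tm L))} (hB : Bs.length = Q.card) {θ : ℕ → Tm L}
    (H : ∀ k : ℕ → J, (fun x => (θ x).realize k) ∈
      Q.sol J (Bs.map fun B => {B.map fun t => t.realize k})) :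
    θ ∈ Q.sol (Tm L) (Bs.map fun B => {B}) := by
  rw [mem_sol_iff_nform (by simpa using hB)]
  replace H := fun k => (mem_sol_iff_nform (by simpa using hB)).1 (H k)
  generalize Q.nform = n at H ⊢
  obtain ⟨d⟩ : Nonempty J := inferInstance
  refine ⟨(H fun _ => d).1, ?_⟩
  -- A single instance already forces the predicate symbols to match, since evaluation does not
  -- change them.
  have hshape : List.Forall₂ (fun A B : GAtom L (Tm L) =>
      (⟨A.arity, A.rel⟩ : Σ n, L.Relations n) = ⟨B.arity, B.rel⟩) n.atoms Bs := by
    obtain ⟨-, m, -, -, h⟩ := H fun _ => d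
    rw [List.forall₂_map_right_iff] at h
    refine h.imp fun A B h => ?_
    have h : A.map _ = B.map _ := h
    obtain ⟨h1, h2, -⟩ := GAtom.mk.inj h
    obtain ⟨a, R, x⟩ := A
    obtain ⟨b, S, y⟩ := B
    simp only at h1 h2
    subst h1
    rw [eq_of_heq h2]
  -- Variables are split by parity: 2p stands for the parameter p occurring in `θ` and `Bs`, and 2x
  -- + 1 for the unknown witness of the bound variable x. Thus a parameter and a bound variable with
  -- the same index do not clash.
  let dbl : ℕ → Tm L := fun p => Term.var (2 * p)
  let ζ : ℕ → Tm L := fun x => if x ∈ n.zs then Term.var (2 * x + 1) else (θ x).subst dbl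
  obtain ⟨μ, hμ, hE⟩ := exists_generic_solution hc hJ
    (substEqs ζ n.eqs ++ (n.atoms.zip Bs).flatMap fun p =>
      atomEqs (p.1.map fun t => t.subst ζ) (p.2.map fun t => t.subst dbl)) {p | Even p} (by
    intro k
    obtain ⟨-, m, hm, h1, h2⟩ := H fun p => k (2 * p)
    -- Even variables receive the given parameters, odd ones the witnesses that the hypothesis
    -- supplies for these parameters.
    let m' : ℕ → J := fun x => if Even x then k x else m (x / 2)
    have hdbl : ∀ x, (dbl x).realize m' = k (2 * x) := by
      intro x
      simp [dbl, m']
    have hζ : ∀ x, (ζ x).realize m' = m x := by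
      intro x
      simp only [ζ]
      split_ifs with hx
      · have : (2 * x + 1) / 2 = x := by omega
        simp [m', this]
      · rw [hm x hx, Term.realize_subst]
        simp only [hdbl]
    refine ⟨m', fun p hp => if_pos hp, ?_⟩
    intro e he
    rw [List.mem_append] at he
    obtain he | he := he
    · obtain ⟨e', he', rfl⟩ := List.mem_map.1 he
      simp only [Term.realize_subst, hζ]
      exact h1 e' he'
    · obtain ⟨⟨A, B⟩, hAB, he⟩ := List.mem_flatMap.1 he
      rw [List.forall₂_map_right_iff, List.forall₂_iff_zip] at h2
      have h3 : A.map _ = B.map _ := h2.2 hAB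
      have h4 : (A.map fun t => t.subst ζ).map (fun t => t.realize m') =
          (B.map fun t => t.subst dbl).map fun t => t.realize m' := by
        simp only [GAtom.map_map, Term.realize_subst, hζ, hdbl]
        exact h3
      exact ((GAtom.map_eq_map_iff _).1 h4).2 e he)
  -- This undoes the doubling of the parameters. The generic solution may also contain odd
  -- variables; their images do not matter.
  let half : ℕ → Tm L := fun x => Term.var (x / 2)
  have hdbl : ∀ t : Tm L, ((t.subst dbl).subst μ).subst half = t := by
    intro t
    rw [subst_subst, subst_subst]
    refine subst_eq_self fun x _ => ?_
    have : μ (2 * x) = Term.var (2 * x) := hμ _ (even_two_mul x)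
    simp [dbl, Term.subst, this, half]
  refine ⟨fun x => ((ζ x).subst μ).subst half, ?_, ?_, ?_⟩
  · intro x hx
    simp only [ζ, hx, if_false]
    exact hdbl _
  · intro e he
    rw [realize_eq_subst, realize_eq_subst, ← subst_subst, ← subst_subst, ← subst_subst,
      ← subst_subst]
    exact congrArg (fun t => t.subst half) (hE (e.1.subst ζ, e.2.subst ζ)
      (List.mem_append_left _ (List.mem_map.2 ⟨e, he, rfl⟩)))
  · rw [List.forall₂_map_right_iff, List.forall₂_iff_zip]
    rw [List.forall₂_iff_zip] at hshape
    refine ⟨hshape.1, fun {A B} hAB => ?_⟩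
    have h0 := hshape.2 hAB
    have hAB' : (⟨(A.map fun t => t.subst ζ).arity, (A.map fun t => t.subst ζ).rel⟩ :
        Σ n, L.Relations n) = ⟨(B.map fun t => t.subst dbl).arity,
          (B.map fun t => t.subst dbl).rel⟩ := h0
    have h1 : (A.map fun t => t.subst ζ).map (fun t => t.subst μ) =
        (B.map fun t => t.subst dbl).map fun t => t.subst μ :=
      (GAtom.map_eq_map_iff _).2 ⟨hAB', fun e he => hE e (List.mem_append_right _
        (List.mem_flatMap.2 ⟨(A, B), hAB, he⟩))⟩
    have h2 := congrArg (GAtom.map fun t => t.subst half) h1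
    simp only [GAtom.map_map, hdbl] at h2
    simp only [realize_eq_subst, Set.mem_singleton_iff]
    simp only [← subst_subst]
    exact h2

/-- A solution of `Q` in `J'` is an instance of the most general unifier θ of the equations of `Q`.
The inclusion in `J`, applied to all instances of θ, makes θ a solution of `Q'` among terms, and
evaluation in `J'` finishes. -/
theorem Query.LeJ.transfer {J : Type w} [(fnPart L).Structure J] [Nontrivial J]
    (hc : Nonempty (L.Functions 0)) (hJ : IsModelFEA L J) {J' : Type w'} [(fnPart L).Structure J']
    (hJ' : IsModelFEA L J') {Q Q' : Query L} (H : LeJ J Q Q') : LeJ J' Q Q' := by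
  refine ⟨H.1, fun Is hIs h hh => ?_⟩
  -- The bound variables of `Q` are moved above `N`, so the witness `g` and the valuation `h` agree
  -- on the free variables of `Q'`.
  obtain ⟨N, hN⟩ : ∃ N, ∀ x ∈ Q'.freeVars, x < N :=
    ⟨Q'.freeVars.sup id + 1, fun x hx => Nat.lt_succ_of_le (Finset.le_sup (f := id) hx)⟩
  rw [mem_sol_iff_nform hIs, ← NForm.sat_shift _ (le_max_left _ N)] at hh
  have hn : ∀ {J : Type w} [(fnPart L).Structure J] (h : ℕ → J) (Is : List (Interp L J)),
      Is.length = Q.card →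
      (h ∈ Q.sol J Is ↔ (Q.nform.shift (max Q.nform.bound N)).Sat h Is) := by
    intro J _ h Is hIs
    rw [mem_sol_iff_nform hIs, ← NForm.sat_shift _ (le_max_left _ N)]
  have hz : ∀ x ∈ Q'.freeVars, x ∉ (Q.nform.shift (max Q.nform.bound N)).zs := by
    intro x hx hz
    have h1 := hN x hx
    have h2 := NForm.le_of_mem_shift x hz
    omega
  have hlen : (Q.nform.shift (max Q.nform.bound N)).atoms.length = Q.card := by
    simp [NForm.shift, substAtoms, length_atoms_nform]
  generalize Q.nform.shift (max Q.nform.bound N) = n at *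
  obtain ⟨hok, g, hg, hE, hA⟩ := hh
  -- The equations have the solution `g` in `J'`, which excludes a contradiction.
  obtain ⟨θ, h1, h2⟩ | hcon := exists_mgu n.eqs
  swap
  · exact absurd hE (hcon.not_realize hJ' g)
  have hθg : ∀ x, g x = (θ x).realize g := fun x => (h2 x).realize_eq hJ' hE
  have key : θ ∈ Q'.sol (Tm L) ((substAtoms θ n.atoms).map fun B => {B}) := by
    refine mem_sol_term_of_forall hc hJ (by simp [substAtoms, hlen, H.1]) fun k => ?_
    refine H.2 _ (by simp [substAtoms, hlen]) ((hn _ _ (by simp [substAtoms, hlen])).2 ?_)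
    refine ⟨hok, fun x => (θ x).realize k, fun _ _ => rfl, ?_, ?_⟩
    · intro e he
      rw [← Term.realize_subst, ← Term.realize_subst, h1 e he]
    · simp only [substAtoms, List.forall₂_map_right_iff, GAtom.map_map, Term.realize_subst,
        Set.mem_singleton_iff]
      exact List.forall₂_same.2 fun _ _ => rfl
  refine sol_congr (fun x hx => hg x (hz x hx)) ?_
  have := sol_map (φ := fun t : Tm L => t.realize g) (fun t h => by
    rw [realize_eq_subst, Term.realize_subst]) (Is' := Is) (by
    simp only [substAtoms, List.map_map, List.forall₂_map_left_iff]
    refine hA.imp fun A I hAI B hB => ?_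
    obtain rfl : B = A.map fun t => t.subst θ := hB
    simp only [GAtom.map_map, Term.realize_subst, ← hθg]
    exact hAI) key
  simpa only [← hθg] using this

/-- The domain of `J` may live in another universe than the models in `Le`, so the converse passes
through the lifted model of terms. -/
theorem Query.leJ_iff_le {J : Type w} [(fnPart L).Structure J] [Nontrivial J]
    (hc : Nonempty (L.Functions 0)) (hJ : IsModelFEA L J) {Q Q' : Query L} :
    LeJ J Q Q' ↔ Le.{u, v, max u w'} Q Q' := by
  constructor
  · intro H J' _ _ hJ'
    exact H.transfer hc hJ hJ'
  · intro H
    obtain ⟨M, S, hM, hFEA⟩ := exists_isModelFEA_nontrivial.{u, v, w'} L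
    exact (H M hFEA).transfer hc hFEA hJ

theorem Query.equivJ_iff {J : Type w} [(fnPart L).Structure J] {Q Q' : Query L} :
    EquivJ J Q Q' ↔ LeJ J Q Q' ∧ LeJ J Q' Q := by
  constructor
  · rintro ⟨h1, h2⟩
    exact ⟨⟨h1, fun Is hI => (h2 Is hI).le⟩, ⟨h1.symm, fun Is hI => (h2 Is (hI.trans h1.symm)).ge⟩⟩
  · rintro ⟨⟨h1, h2⟩, -, h3⟩
    exact ⟨h1, fun Is hI => (h2 Is hI).antisymm (h3 Is (hI.trans h1))⟩

theorem Query.equivJ_iff_equivalent {J : Type w} [(fnPart L).Structure J] [Nontrivial J]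
    (hc : Nonempty (L.Functions 0)) (hJ : IsModelFEA L J) {Q Q' : Query L} :
    EquivJ J Q Q' ↔ Equivalent.{u, v, max u w'} Q Q' := by
  rw [equivJ_iff, leJ_iff_le.{u, v, w, w'} hc hJ, leJ_iff_le.{u, v, w, w'} hc hJ, Equivalent]

end Transfer

end QueryLattice

namespace QueryLattice

open FirstOrder.Language FirstOrder.Language.Structure

variable {L : FirstOrder.Language.{u, v}}

namespace Query

/-! ### Conjunctions up to bracketing -/

section Conjunctions

/-- `Q` is a conjunction of equations and atoms. -/
def Flat : Query L → Prop
  | eq _ _ => True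
  | atom _ => True
  | and Q₁ Q₂ => Q₁.Flat ∧ Q₂.Flat
  | _ => False

/-- The equation that `Q` is, if it is one. -/
def asEq : Query L → Option (Tm L × Tm L)
  | eq s t => some (s, t)
  | _ => none

/-- The atom that `Q` is, if it is one. -/
def asAtom : Query L → Option (GAtom L (Tm L))
  | atom A => some A
  | _ => none

/-- Equations with a variable on the left, as pairs of terms. -/
def varEqs (eqs : List (ℕ × Tm L)) : List (Tm L × Tm L) :=
  eqs.map fun e => (Term.var e.1, e.2)

theorem Flat.of_conjuncts {B : Query L} (H : ∀ C ∈ B.conjuncts, C.asEq ≠ none ∨ C.asAtom ≠ none) :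
    B.Flat := by
  induction B with
  | and B₁ B₂ ih₁ ih₂ =>
    exact ⟨ih₁ fun C hC => H C (List.mem_append_left _ hC),
      ih₂ fun C hC => H C (List.mem_append_right _ hC)⟩
  | _ => simp_all [conjuncts, asEq, asAtom, Flat]

theorem flat_of_conjuncts_eq {B : Query L} {eqs : List (ℕ × Tm L)} {As : List (GAtom L (Tm L))}
    (H : B.conjuncts = eqs.map (fun e => eq (Term.var e.1) e.2) ++ As.map atom) : B.Flat := by
  refine Flat.of_conjuncts fun C hC => ?_
  rw [H, List.mem_append, List.mem_map, List.mem_map] at hC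
  obtain ⟨e, -, rfl⟩ | ⟨A, -, rfl⟩ := hC
  · exact .inl (by simp [asEq])
  · exact .inr (by simp [asAtom])

theorem filterMap_asEq {B : Query L} {eqs : List (ℕ × Tm L)} {As : List (GAtom L (Tm L))}
    (H : B.conjuncts = eqs.map (fun e => eq (Term.var e.1) e.2) ++ As.map atom) :
    B.conjuncts.filterMap asEq = varEqs eqs := by
  have h1 : (asEq ∘ fun e : ℕ × Tm L => eq (Term.var e.1) e.2) =
      fun e => some (Term.var e.1, e.2) := rfl
  have h2 : (asEq ∘ atom : GAtom L (Tm L) → _) = fun _ => none := rfl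
  rw [H, List.filterMap_append, List.filterMap_map, List.filterMap_map, h1, h2]
  simp [varEqs]

theorem filterMap_asAtom {B : Query L} {eqs : List (ℕ × Tm L)} {As : List (GAtom L (Tm L))}
    (H : B.conjuncts = eqs.map (fun e => eq (Term.var e.1) e.2) ++ As.map atom) :
    B.conjuncts.filterMap asAtom = As := by
  have h1 : (asAtom ∘ fun e : ℕ × Tm L => eq (Term.var e.1) e.2) = fun _ => none := rfl
  have h2 : (asAtom ∘ atom : GAtom L (Tm L) → _) = some := rfl
  rw [H, List.filterMap_append, List.filterMap_map, List.filterMap_map, h1, h2]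
  simp

theorem Flat.length_atoms {B : Query L} (hB : B.Flat) :
    (B.conjuncts.filterMap asAtom).length = B.card := by
  induction B with
  | and B₁ B₂ ih₁ ih₂ => simp [conjuncts, card, List.filterMap_append, ih₁ hB.1, ih₂ hB.2]
  | _ => first | exact hB.elim | rfl

theorem Flat.mem_sol_iff {J : Type w} [(fnPart L).Structure J] {B : Query L} (hB : B.Flat) :
    ∀ {h : ℕ → J} {Is : List (Interp L J)}, Is.length = B.card →
    (h ∈ B.sol J Is ↔
      BodySat (B.conjuncts.filterMap asEq) (B.conjuncts.filterMap asAtom) h Is) := by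
  induction B with
  | and B₁ B₂ ih₁ ih₂ =>
    intro h Is hI
    simp only [card] at hI
    simp only [conjuncts, List.filterMap_append]
    rw [bodySat_append, hB.1.length_atoms, ← ih₁ hB.1 (by simp; omega),
      ← ih₂ hB.2 (by simp; omega)]
    rfl
  | eq s t =>
    intro h Is hI
    obtain rfl : Is = [] := List.length_eq_zero_iff.1 hI
    simp [sol, BodySat, conjuncts, asEq, asAtom]
  | atom A =>
    intro h Is hI
    obtain ⟨I, rfl⟩ := List.length_eq_one_iff.1 hI
    simp [sol, BodySat, conjuncts, asEq, asAtom]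
  | _ => exact hB.elim

theorem Flat.subst {B : Query L} (hB : B.Flat) (σ : ℕ → Tm L) : (B.subst σ).Flat := by
  induction B with
  | and B₁ B₂ ih₁ ih₂ => exact ⟨ih₁ hB.1, ih₂ hB.2⟩
  | _ => exact hB

theorem Flat.substitutible {B : Query L} (hB : B.Flat) (σ : ℕ → Tm L) : B.Substitutible σ := by
  induction B with
  | and B₁ B₂ ih₁ ih₂ => exact ⟨ih₁ hB.1, ih₂ hB.2⟩
  | ex => exact hB.elim
  | _ => trivial

/-- Without quantifiers no variable can be captured; with them substitutions need not compose. -/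
theorem Flat.subst_subst {B : Query L} (hB : B.Flat) (σ τ : ℕ → Tm L) :
    (B.subst σ).subst τ = B.subst fun x => (σ x).subst τ := by
  induction B with
  | and B₁ B₂ ih₁ ih₂ => simp only [Query.subst, ih₁ hB.1, ih₂ hB.2]
  | eq s t => simp only [Query.subst, QueryLattice.subst_subst]
  | atom A => simp only [Query.subst, QueryLattice.subst_subst, GAtom.map_map]
  | _ => exact hB.elim

theorem conjuncts_subst (B : Query L) (σ : ℕ → Tm L) :
    (B.subst σ).conjuncts = B.conjuncts.map fun C => C.subst σ := by
  induction B with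
  | and B₁ B₂ ih₁ ih₂ => simp [Query.subst, conjuncts, ih₁, ih₂]
  | _ => rfl

theorem Flat.bodyVar_of_mem_freeVars {B : Query L} (hB : B.Flat) {x : ℕ} (hx : x ∈ B.freeVars) :
    BodyVar (B.conjuncts.filterMap asEq) (B.conjuncts.filterMap asAtom) x := by
  induction B with
  | and B₁ B₂ ih₁ ih₂ =>
    simp only [conjuncts, List.filterMap_append]
    obtain hx | hx := Finset.mem_union.1 hx
    · obtain ⟨e, he, h⟩ | ⟨A, hA, h⟩ := ih₁ hB.1 hx
      · exact .inl ⟨e, List.mem_append_left _ he, h⟩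
      · exact .inr ⟨A, List.mem_append_left _ hA, h⟩
    · obtain ⟨e, he, h⟩ | ⟨A, hA, h⟩ := ih₂ hB.2 hx
      · exact .inl ⟨e, List.mem_append_right _ he, h⟩
      · exact .inr ⟨A, List.mem_append_right _ hA, h⟩
  | eq s t =>
    exact .inl ⟨(s, t), by simp [conjuncts, asEq], Finset.mem_union.1 hx⟩
  | atom A => exact .inr ⟨A, by simp [conjuncts, asAtom], hx⟩
  | _ => exact hB.elim

theorem Flat.exists_of_mem_freeVars_subst {B : Query L} (hB : B.Flat) {σ : ℕ → Tm L} {y : ℕ}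
    (hy : y ∈ (B.subst σ).freeVars) : ∃ x ∈ B.freeVars, y ∈ (σ x).varFinset := by
  induction B with
  | and B₁ B₂ ih₁ ih₂ =>
    obtain hy | hy := Finset.mem_union.1 hy
    · obtain ⟨x, hx, h⟩ := ih₁ hB.1 hy
      exact ⟨x, Finset.mem_union_left _ hx, h⟩
    · obtain ⟨x, hx, h⟩ := ih₂ hB.2 hy
      exact ⟨x, Finset.mem_union_right _ hx, h⟩
  | eq s t =>
    obtain hy | hy := Finset.mem_union.1 hy
    · obtain ⟨x, hx, h⟩ := mem_varFinset_subst.1 hy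
      exact ⟨x, Finset.mem_union_left _ hx, h⟩
    · obtain ⟨x, hx, h⟩ := mem_varFinset_subst.1 hy
      exact ⟨x, Finset.mem_union_right _ hx, h⟩
  | atom A =>
    obtain ⟨i, hi⟩ := GAtom.mem_vars.1 hy
    obtain ⟨x, hx, h⟩ := mem_varFinset_subst.1 hi
    exact ⟨x, GAtom.mem_vars.2 ⟨i, hx⟩, h⟩
  | _ => exact hB.elim

end Conjunctions

/-! ### Quantifier prefixes and their variants -/

section Quantifiers

theorem card_exs (zs : List ℕ) (B : Query L) : (exs zs B).card = B.card := by
  induction zs with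
  | nil => rfl
  | cons z zs ih => exact ih

theorem freeVars_exs_subset (zs : List ℕ) (B : Query L) : (exs zs B).freeVars ⊆ B.freeVars := by
  induction zs with
  | nil => exact subset_rfl
  | cons z zs ih => exact (Finset.erase_subset _ _).trans ih

theorem subst_exs {zs : List ℕ} {σ : ℕ → Tm L} (hσ : ∀ z ∈ zs, σ z = Term.var z) (B : Query L) :
    (exs zs B).subst σ = exs zs (B.subst σ) := by
  induction zs with
  | nil => rfl
  | cons z zs ih =>
    change ex z ((exs zs B).subst (Function.update σ z (Term.var z))) = _
    rw [← hσ z List.mem_cons_self, Function.update_eq_self,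
      ih fun z hz => hσ z (List.mem_cons_of_mem _ hz)]
    rfl

theorem substitutible_exs {zs : List ℕ} {σ : ℕ → Tm L} (hσ : ∀ z ∈ zs, σ z = Term.var z)
    (hσ' : ∀ z ∈ zs, ∀ x, x ≠ z → z ∉ (σ x).varFinset) {B : Query L} (hB : B.Flat) :
    (exs zs B).Substitutible σ := by
  induction zs with
  | nil => exact hB.substitutible σ
  | cons z zs ih =>
    refine ⟨fun x _ hx => hσ' z List.mem_cons_self x hx, ?_⟩
    rw [← hσ z List.mem_cons_self, Function.update_eq_self]
    exact ih (fun z hz => hσ z (List.mem_cons_of_mem _ hz))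
      fun z hz => hσ' z (List.mem_cons_of_mem _ hz)

theorem mem_sol_exs {J : Type w} [(fnPart L).Structure J] {zs : List ℕ} {B : Query L}
    (hB : B.Flat) : ∀ {h : ℕ → J} {Is : List (Interp L J)}, Is.length = B.card →
    (h ∈ (exs zs B).sol J Is ↔
      ExSat zs (B.conjuncts.filterMap asEq) (B.conjuncts.filterMap asAtom) h Is) := by
  induction zs with
  | nil =>
    intro h Is hI
    rw [exSat_nil]
    exact hB.mem_sol_iff hI
  | cons z zs ih =>
    intro h Is hI
    rw [exSat_cons]
    exact exists_congr fun d => ih hI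

/-- Renaming the quantified variables of a prenex query to fresh ones gives a variant. -/
theorem variant_exs {zs : List ℕ} {B : Query L} (hB : B.Flat) {ρ : ℕ → ℕ} (hzs : zs.Nodup)
    (hρ : (zs.map ρ).Nodup) (h1 : ∀ z ∈ zs, ρ z ∉ zs) (h2 : ∀ z ∈ zs, ρ z ∉ B.freeVars) :
    Variant (exs zs B) (exs (zs.map ρ) (B.subst (rename ρ zs))) := by
  induction zs with
  | nil =>
    have : B.subst (rename ρ []) = B := by
      have : (rename ρ [] : ℕ → Tm L) = Term.var := by
        funext x
        simp [rename]
      rw [this]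
      clear h1 h2
      induction B with
      | and B₁ B₂ ih₁ ih₂ => simp only [Query.subst, ih₁ hB.1, ih₂ hB.2]
      | eq s t => simp only [Query.subst, subst_var]
      | atom A => simp only [Query.subst, subst_var, GAtom.map]
      | _ => exact hB.elim
    rw [this]
    exact .refl
  | cons z zs ih =>
    rw [List.nodup_cons] at hzs
    rw [List.map_cons, List.nodup_cons] at hρ
    have ih := ih hzs.2 hρ.2
      (fun y hy h => h1 y (List.mem_cons_of_mem _ hy) (List.mem_cons_of_mem _ h))
      (fun y hy => h2 y (List.mem_cons_of_mem _ hy))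
    have hne : ∀ y ∈ zs, ρ y ≠ z := fun y hy h =>
      h1 y (List.mem_cons_of_mem _ hy) (h ▸ List.mem_cons_self)
    -- The inner quantifiers are renamed first, by induction; the outermost one is then renamed by
    -- one step, legitimate because `ρ z` differs from the new inner names and is not free in `B`.
    have step := RenameStep.here z (ρ z) (exs (zs.map ρ) (B.subst (rename ρ zs))) (by
      intro hmem
      obtain ⟨x, hx, hzx⟩ := hB.exists_of_mem_freeVars_subst (freeVars_exs_subset _ _ hmem)
      simp only [rename, Term.varFinset, Finset.mem_singleton] at hzx
      split_ifs at hzx with hxz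
      · exact hρ.1 (hzx ▸ List.mem_map_of_mem hxz)
      · exact h2 z List.mem_cons_self (hzx ▸ hx))
    have hs1 : ∀ y ∈ zs.map ρ, (single z (ρ z) : ℕ → Tm L) y = Term.var y := by
      intro y hy
      obtain ⟨x, hx, rfl⟩ := List.mem_map.1 hy
      exact Function.update_of_ne (hne x hx) _ _
    have hs2 : ∀ y ∈ zs.map ρ, ∀ x, x ≠ y → y ∉ ((single z (ρ z) : ℕ → Tm L) x).varFinset := by
      intro y hy x hxy hmem
      by_cases hxz : x = z
      · subst hxz
        simp only [single, Function.update_self, Term.varFinset, Finset.mem_singleton] at hmem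
        exact hρ.1 (hmem ▸ hy)
      · simp only [single, Function.update_of_ne hxz, Term.varFinset, Finset.mem_singleton] at hmem
        exact hxy hmem.symm
    have step := step (substitutible_exs hs1 hs2 (hB.subst _))
    rw [subst_exs hs1, hB.subst_subst] at step
    have hcomp : (fun x => ((rename ρ zs : ℕ → Tm L) x).subst (single z (ρ z))) =
        rename ρ (z :: zs) := by
      funext x
      simp only [rename, Term.subst, List.mem_cons]
      by_cases hxz : x = z
      · subst hxz
        simp [hzs.1, single]
      · by_cases hx : x ∈ zs
        · simp [hx, hxz, single, Function.update_of_ne (hne x hx)]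
        · simp [hx, hxz, single]
    rw [hcomp] at step
    exact (Relation.ReflTransGen.lift (p := RenameStep) (Query.ex z) (fun _ _ h => RenameStep.ex z h) _ _ ih).tail step

end Quantifiers

/-! ### Queries given by bound variables, equations and atoms -/

section Forms

theorem HasForm.card_eq {Q : Query L} {zs : List ℕ} {eqs : List (ℕ × Tm L)}
    {As : List (GAtom L (Tm L))} (H : Q.HasForm zs eqs As) : Q.card = As.length := by
  obtain ⟨B, rfl, hB⟩ := H
  rw [card_exs, ← (flat_of_conjuncts_eq hB).length_atoms, filterMap_asAtom hB]

theorem HasForm.mem_sol_iff {J : Type w} [(fnPart L).Structure J] {Q : Query L} {zs : List ℕ}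
    {eqs : List (ℕ × Tm L)} {As : List (GAtom L (Tm L))} (H : Q.HasForm zs eqs As) {h : ℕ → J}
    {Is : List (Interp L J)} (hI : Is.length = As.length) :
    h ∈ Q.sol J Is ↔ ExSat zs (varEqs eqs) As h Is := by
  have hc := H.card_eq
  obtain ⟨B, rfl, hB⟩ := H
  rw [card_exs] at hc
  rw [mem_sol_exs (flat_of_conjuncts_eq hB) (hI.trans hc.symm), filterMap_asAtom hB,
    filterMap_asEq hB]

/-- Equations after the variable on the left is replaced by `τ` and the right side by `σ`. -/
def mapEqs (τ : ℕ → ℕ) (σ : ℕ → Tm L) (eqs : List (ℕ × Tm L)) : List (ℕ × Tm L) :=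
  eqs.map fun e => (τ e.1, e.2.subst σ)

theorem conjuncts_subst_eq {B : Query L} {eqs : List (ℕ × Tm L)} {As : List (GAtom L (Tm L))}
    (H : B.conjuncts = eqs.map (fun e => eq (Term.var e.1) e.2) ++ As.map atom) {τ : ℕ → ℕ}
    {σ : ℕ → Tm L} (hσ : ∀ x ∈ eqs.map Prod.fst, σ x = Term.var (τ x)) :
    (B.subst σ).conjuncts = (mapEqs τ σ eqs).map (fun e => eq (Term.var e.1) e.2) ++
      (substAtoms σ As).map atom := by
  rw [conjuncts_subst, H, List.map_append, List.map_map, List.map_map, mapEqs, substAtoms,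
    List.map_map, List.map_map]
  congr 1
  refine List.map_congr_left fun e he => ?_
  simp only [Function.comp, Query.subst, Term.subst, hσ e.1 (List.mem_map_of_mem he)]

theorem HasForm.exists_variant {Q : Query L} {zs : List ℕ} {eqs : List (ℕ × Tm L)}
    {As : List (GAtom L (Tm L))} (H : Q.HasForm zs eqs As) {ρ : ℕ → ℕ} (hzs : zs.Nodup)
    (hX : ∀ x ∈ eqs.map Prod.fst, x ∉ zs)
    (hρ : (zs.map ρ).Nodup) (h1 : ∀ z ∈ zs, ρ z ∉ zs)
    (h2 : ∀ z ∈ zs, ¬ BodyVar (varEqs eqs) As (ρ z)) :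
    ∃ Q', Variant Q Q' ∧ Q'.HasForm (zs.map ρ) (mapEqs id (rename ρ zs) eqs)
      (substAtoms (rename ρ zs) As) := by
  obtain ⟨B, rfl, hB⟩ := H
  have hF := flat_of_conjuncts_eq hB
  refine ⟨_, variant_exs hF hzs hρ h1 fun z hz h => h2 z hz ?_, _, rfl,
    conjuncts_subst_eq hB fun x hx => ?_⟩
  · have := hF.bodyVar_of_mem_freeVars h
    rwa [filterMap_asAtom hB, filterMap_asEq hB] at this
  · simp [rename, hX x hx]

end Forms

/-! ### Redirecting equations -/

section Swaps

/-- The exchange of the two variables of each of the given pairs. -/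
def swapVar : List (ℕ × ℕ) → ℕ → ℕ
  | [] => id
  | p :: ps => Function.update (Function.update (swapVar ps) p.1 p.2) p.2 p.1

theorem swap_eq_var (ps : List (ℕ × ℕ)) (x : ℕ) :
    (swap ps : ℕ → Tm L) x = Term.var (swapVar ps x) := by
  induction ps with
  | nil => rfl
  | cons p ps ih =>
    simp only [swap, swapVar, Function.update_apply]
    split_ifs
    · rfl
    · rfl
    · exact ih

theorem swapVar_of_notMem {ps : List (ℕ × ℕ)} {x : ℕ} (h1 : x ∉ ps.map Prod.fst)
    (h2 : x ∉ ps.map Prod.snd) : swapVar ps x = x := by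
  induction ps with
  | nil => rfl
  | cons p ps ih =>
    simp only [List.map_cons, List.mem_cons, not_or] at h1 h2
    rw [swapVar, Function.update_of_ne h2.1, Function.update_of_ne h1.1, ih h1.2 h2.2]

theorem swapVar_mem {ps : List (ℕ × ℕ)} (hps : (ps.map Prod.fst ++ ps.map Prod.snd).Nodup)
    {p : ℕ × ℕ} (hp : p ∈ ps) : swapVar ps p.1 = p.2 ∧ swapVar ps p.2 = p.1 := by
  induction ps with
  | nil => simp at hp
  | cons q ps ih =>
    simp only [List.map_cons, List.cons_append, List.nodup_cons, List.nodup_append,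
      List.mem_append, List.mem_cons, not_or] at hps
    obtain ⟨⟨h1, h2, h3⟩, h4, ⟨h5, h6⟩, h7⟩ := hps
    obtain rfl | hp := List.mem_cons.1 hp
    · exact ⟨by rw [swapVar, Function.update_of_ne h2, Function.update_self],
        by rw [swapVar, Function.update_self]⟩
    · have hps' : (ps.map Prod.fst ++ ps.map Prod.snd).Nodup :=
        List.nodup_append.2 ⟨h4, h6, fun a ha b hb => h7 a ha b (.inr hb)⟩
      have hp1 := List.mem_map_of_mem (f := Prod.fst) hp
      have hp2 := List.mem_map_of_mem (f := Prod.snd) hp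
      obtain ⟨ih1, ih2⟩ := ih hps' hp
      constructor
      · rw [swapVar, Function.update_of_ne (h7 _ hp1 _ (.inl rfl)),
          Function.update_of_ne (ne_of_mem_of_not_mem hp1 h1), ih1]
      · rw [swapVar, Function.update_of_ne (ne_of_mem_of_not_mem hp2 h5),
          Function.update_of_ne (ne_of_mem_of_not_mem hp2 h3), ih2]

theorem swapVar_swapVar {ps : List (ℕ × ℕ)} (hps : (ps.map Prod.fst ++ ps.map Prod.snd).Nodup)
    (x : ℕ) : swapVar ps (swapVar ps x) = x := by
  by_cases h1 : x ∈ ps.map Prod.fst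
  · obtain ⟨p, hp, rfl⟩ := List.mem_map.1 h1
    rw [(swapVar_mem hps hp).1, (swapVar_mem hps hp).2]
  · by_cases h2 : x ∈ ps.map Prod.snd
    · obtain ⟨p, hp, rfl⟩ := List.mem_map.1 h2
      rw [(swapVar_mem hps hp).2, (swapVar_mem hps hp).1]
    · rw [swapVar_of_notMem h1 h2, swapVar_of_notMem h1 h2]

/-- The exchange is an involution that fixes every bound variable, so it sends no other variable to
a bound one; hence nothing is captured. -/
theorem HasForm.exists_redirectStep {Q : Query L} {zs : List ℕ} {eqs : List (ℕ × Tm L)}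
    {As : List (GAtom L (Tm L))} (H : Q.HasForm zs eqs As) {ps : List (ℕ × ℕ)}
    (h1 : ∀ p ∈ ps, (p.1, Term.var p.2) ∈ eqs)
    (h2 : (ps.map Prod.fst ++ ps.map Prod.snd).Nodup)
    (h3 : ∀ z ∈ zs, swapVar ps z = z) :
    ∃ Q', RedirectStep Q Q' ∧ Q'.HasForm zs (mapEqs (swapVar ps) (swap ps) eqs)
      (substAtoms (swap ps) As) := by
  have H' := H
  obtain ⟨B, rfl, hB⟩ := H
  have hs1 : ∀ z ∈ zs, (swap ps : ℕ → Tm L) z = Term.var z := fun z hz => by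
    rw [swap_eq_var, h3 z hz]
  refine ⟨_, ⟨zs, eqs, As, ps, H', h1, h2, ?_, rfl⟩, B.subst (swap ps), subst_exs hs1 B,
    conjuncts_subst_eq hB fun x _ => swap_eq_var ps x⟩
  refine substitutible_exs hs1 (fun z hz x hxz hmem => hxz ?_) (flat_of_conjuncts_eq hB)
  simp only [swap_eq_var, Term.varFinset, Finset.mem_singleton] at hmem
  rw [← swapVar_swapVar h2 x, ← hmem, h3 z hz]

end Swaps

end Query

end QueryLattice

namespace QueryLattice

open FirstOrder.Language FirstOrder.Language.Structure

variable {L : FirstOrder.Language.{u, v}}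

namespace Query

/-! ### Solved forms that are instances of each other -/

section SolvedForms

/-- The conditions on the bound variables, equations and atoms of a query in solved form. -/
structure IsSolved (zs : List ℕ) (eqs : List (ℕ × Tm L)) (As : List (GAtom L (Tm L))) : Prop where
  nodup : (eqs.map Prod.fst ++ zs).Nodup
  notMem_eqs : ∀ x ∈ eqs.map Prod.fst, ∀ e ∈ eqs, x ∉ e.2.varFinset
  notMem_atoms : ∀ x ∈ eqs.map Prod.fst, ∀ A ∈ As, x ∉ A.vars
  occurs : ∀ z ∈ zs, (∃ e ∈ eqs, z ∈ e.2.varFinset) ∨ ∃ A ∈ As, z ∈ A.vars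
  ne_var : ∀ z ∈ zs, ∀ e ∈ eqs, e.2 ≠ Term.var z

/-- The substitution given by equations with a variable on the left. -/
noncomputable def solution (eqs : List (ℕ × Tm L)) (x : ℕ) : Tm L :=
  open Classical in if h : ∃ s, (x, s) ∈ eqs then h.choose else Term.var x

variable {zs zs' : List ℕ} {eqs eqs' : List (ℕ × Tm L)} {As As' : List (GAtom L (Tm L))}

theorem solution_mem {x : ℕ} (hx : x ∈ eqs.map Prod.fst) : (x, solution eqs x) ∈ eqs := by
  have h : ∃ s, (x, s) ∈ eqs := by
    obtain ⟨e, he, rfl⟩ := List.mem_map.1 hx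
    exact ⟨e.2, he⟩
  rw [solution, dif_pos h]
  exact h.choose_spec

theorem solution_of_notMem {x : ℕ} (hx : x ∉ eqs.map Prod.fst) : solution eqs x = Term.var x :=
  dif_neg fun ⟨_, hs⟩ => hx (List.mem_map_of_mem (f := Prod.fst) hs)

theorem snd_eq_of_nodup (h : (eqs.map Prod.fst).Nodup) {x : ℕ} {s t : Tm L} (hs : (x, s) ∈ eqs)
    (ht : (x, t) ∈ eqs) : s = t :=
  (Prod.ext_iff.1 (List.inj_on_of_nodup_map h hs ht rfl)).2

theorem substAtoms_eq_self {σ : ℕ → Tm L} (h : ∀ A ∈ As, ∀ x ∈ A.vars, σ x = Term.var x) :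
    substAtoms σ As = As := by
  conv_rhs => rw [← List.map_id As]
  refine List.map_congr_left fun A hA => ?_
  simp only [GAtom.map, id]
  congr 1
  funext i
  exact subst_eq_self fun x hx => h A hA x (GAtom.mem_vars.2 ⟨i, hx⟩)

namespace IsSolved

theorem nodup_fst (H : IsSolved zs eqs As) : (eqs.map Prod.fst).Nodup :=
  (List.nodup_append.1 H.nodup).1

theorem nodup_bound (H : IsSolved zs eqs As) : zs.Nodup :=
  (List.nodup_append.1 H.nodup).2.1

theorem fst_notMem_bound (H : IsSolved zs eqs As) {x : ℕ} (hx : x ∈ eqs.map Prod.fst) : x ∉ zs :=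
  fun hz => (List.nodup_append.1 H.nodup).2.2 x hx x hz rfl

theorem solution_eq (H : IsSolved zs eqs As) {x : ℕ} {s : Tm L} (h : (x, s) ∈ eqs) :
    solution eqs x = s :=
  snd_eq_of_nodup H.nodup_fst (solution_mem (List.mem_map_of_mem (f := Prod.fst) h)) h

theorem substAtoms_solution (H : IsSolved zs eqs As) : substAtoms (solution eqs) As = As :=
  substAtoms_eq_self fun A hA x hx =>
    solution_of_notMem fun h => H.notMem_atoms x h A hA hx

/-- A solved form is satisfied by its generic solution in the model of terms. -/
theorem exSat_solution (H : IsSolved zs eqs As) :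
    ExSat zs (varEqs eqs) As (solution eqs) (As.map fun A => {A}) := by
  refine ⟨solution eqs, fun _ _ => rfl, ?_, ?_⟩
  · intro e he
    obtain ⟨e', he', rfl⟩ := List.mem_map.1 he
    rw [Term.realize_var, realize_eq_subst, H.solution_eq he']
    exact (subst_eq_self fun x hx => solution_of_notMem fun h => H.notMem_eqs x h e' he' hx).symm
  · have h0 := H.substAtoms_solution
    simp only [List.forall₂_map_right_iff, Set.mem_singleton_iff, realize_eq_subst]
    rw [substAtoms] at h0
    rw [← List.forall₂_map_left_iff (f := fun A : GAtom L (Tm L) =>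
      A.map fun t => t.subst (solution eqs)) (R := fun A B => A = B), h0]
    exact List.forall₂_same.2 fun _ _ => rfl

/-- The inclusion of the solution sets in the model of terms, tested on the generic solution. -/
theorem exists_instance (H : IsSolved zs eqs As)
    (hle : ∀ (h : ℕ → Tm L) (Is : List (Interp L (Tm L))), Is.length = As.length →
      ExSat zs (varEqs eqs) As h Is → ExSat zs' (varEqs eqs') As' h Is) :
    ∃ g : ℕ → Tm L, (∀ x, x ∉ zs' → solution eqs x = (solution eqs' x).subst g) ∧
      substAtoms g As' = As ∧ ∀ x, x ∉ zs' → g x = solution eqs x := by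
  obtain ⟨g, hg, h1, h2⟩ := hle (solution eqs) (As.map fun A => {A}) (by simp) H.exSat_solution
  refine ⟨g, fun x hx => ?_, ?_, hg⟩
  · by_cases hX : x ∈ eqs'.map Prod.fst
    · have := h1 _ (List.mem_map_of_mem (solution_mem hX))
      rw [Term.realize_var, realize_eq_subst] at this
      rw [← hg x hx, this]
    · rw [solution_of_notMem hX]
      exact (hg x hx).symm
  · simp only [List.forall₂_map_right_iff, Set.mem_singleton_iff, realize_eq_subst] at h2
    rw [← List.forall₂_map_left_iff (f := fun A : GAtom L (Tm L) =>
      A.map fun t => t.subst g) (R := fun A B => A = B), List.forall₂_eq_eq_eq] at h2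
    exact h2

/-- The bound variables of one solved form occur neither in it freely nor in the other one. -/
structure Apart (zs zs' : List ℕ) (eqs' : List (ℕ × Tm L)) (As' : List (GAtom L (Tm L))) :
    Prop where
  bound : ∀ z ∈ zs, z ∉ zs'
  body : ∀ z ∈ zs, ¬ BodyVar (varEqs eqs') As' z

theorem Apart.notMem_fst (h : Apart zs zs' eqs' As') {z : ℕ} (hz : z ∈ zs) :
    z ∉ eqs'.map Prod.fst := by
  intro hz'
  obtain ⟨e, he, rfl⟩ := List.mem_map.1 hz'
  exact h.body _ hz (.inl ⟨_, List.mem_map_of_mem he, .inl (by simp)⟩)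

theorem Apart.notMem_snd (h : Apart zs zs' eqs' As') {z : ℕ} (hz : z ∈ zs) {e : ℕ × Tm L}
    (he : e ∈ eqs') : z ∉ e.2.varFinset :=
  fun hz' => h.body _ hz (.inl ⟨_, List.mem_map_of_mem he, .inr hz'⟩)

theorem Apart.notMem_atom (h : Apart zs zs' eqs' As') {z : ℕ} (hz : z ∈ zs)
    {A : GAtom L (Tm L)} (hA : A ∈ As') : z ∉ A.vars :=
  fun hz' => h.body _ hz (.inr ⟨A, hA, hz'⟩)

/-- Two solved forms without common bound variables that are instances of each other. -/
structure Instances (zs zs' : List ℕ) (eqs eqs' : List (ℕ × Tm L))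
    (As As' : List (GAtom L (Tm L))) (g g' : ℕ → Tm L) : Prop where
  left : IsSolved zs eqs As
  right : IsSolved zs' eqs' As'
  apart : Apart zs zs' eqs' As'
  apart' : Apart zs' zs eqs As
  eq_subst : ∀ x, x ∉ zs' → solution eqs x = (solution eqs' x).subst g'
  eq_subst' : ∀ x, x ∉ zs → solution eqs' x = (solution eqs x).subst g
  atoms : substAtoms g' As' = As
  atoms' : substAtoms g As = As'
  agree : ∀ x, x ∉ zs' → g' x = solution eqs x
  agree' : ∀ x, x ∉ zs → g x = solution eqs' x

variable {g g' : ℕ → Tm L}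

theorem Instances.symm (H : Instances zs zs' eqs eqs' As As' g g') :
    Instances zs' zs eqs' eqs As' As g' g :=
  ⟨H.right, H.left, H.apart', H.apart, H.eq_subst', H.eq_subst, H.atoms', H.atoms, H.agree',
    H.agree⟩

theorem atom_subst_mem {σ : ℕ → Tm L} (h : substAtoms σ As = As') {A : GAtom L (Tm L)}
    (hA : A ∈ As) : (A.map fun t => t.subst σ) ∈ As' := by
  rw [← h]
  exact List.mem_map_of_mem hA

theorem atom_subst_eq_self {σ : ℕ → Tm L} (h : substAtoms σ As = As) {A : GAtom L (Tm L)}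
    (hA : A ∈ As) : (A.map fun t => t.subst σ) = A := by
  have h2 : As.map (fun A => A.map fun t => t.subst σ) = As.map id := by
    rw [List.map_id]
    exact h
  exact List.map_inj_left.1 h2 A hA

/-- A bound variable occurs in a right side or an atom, and the round trip through the other form
restores that term; comparing instances gives the value at each variable. For a free variable the
two instance equations compose directly. -/
theorem Instances.subst_subst_var (H : Instances zs zs' eqs eqs' As As' g g') {x : ℕ}
    (hx : x ∉ eqs.map Prod.fst) (hx' : x ∉ zs') : (g x).subst g' = Term.var x := by
  by_cases hz : x ∈ zs
  · obtain ⟨e, he, hxe⟩ | ⟨A, hA, hxA⟩ := H.left.occurs x hz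
    · have he1 : e.1 ∈ eqs.map Prod.fst := List.mem_map_of_mem he
      have h1 := H.eq_subst e.1 fun h => H.apart'.notMem_fst h he1
      rw [H.eq_subst' e.1 (H.left.fst_notMem_bound he1), H.left.solution_eq he, subst_subst] at h1
      exact eq_of_subst_eq (h1.symm.trans (subst_var _).symm) hxe
    · have h1 : substAtoms (fun x => (g x).subst g') As = As := by
        conv_rhs => rw [← H.atoms, ← H.atoms']
        simp only [substAtoms, List.map_map, Function.comp_def, GAtom.map_map, subst_subst]
      have h2 := atom_subst_eq_self h1 hA
      obtain ⟨i, hi⟩ := GAtom.mem_vars.1 hxA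
      obtain ⟨n, R, a⟩ := A
      simp only [GAtom.map, GAtom.mk.injEq, heq_eq_eq, true_and] at h2
      exact eq_of_subst_eq ((congrFun h2 i).trans (subst_var _).symm) hi
  · have h1 := H.eq_subst x hx'
    rw [H.eq_subst' x hz, solution_of_notMem hx] at h1
    exact h1.symm

/-- The variable to which a variable is sent. -/
noncomputable def Instances.ren (_ : Instances zs zs' eqs eqs' As As' g g') (x : ℕ) : ℕ :=
  open Classical in if h : ∃ y, g x = Term.var y then h.choose else x

theorem Instances.eq_ren (H : Instances zs zs' eqs eqs' As As' g g') {x : ℕ}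
    (hx : x ∉ eqs.map Prod.fst) (hx' : x ∉ zs') :
    g x = Term.var (H.ren x) ∧ g' (H.ren x) = Term.var x := by
  have h1 := H.subst_subst_var hx hx'
  have h2 : ∃ y, g x = Term.var y := by
    cases h : g x with
    | var y => exact ⟨y, rfl⟩
    | func f ts =>
      rw [h] at h1
      simp [Term.subst] at h1
  have h3 : g x = Term.var (H.ren x) := by
    rw [Instances.ren, dif_pos h2]
    exact h2.choose_spec
  refine ⟨h3, ?_⟩
  rw [h3] at h1
  exact h1

theorem Instances.good_bound (H : Instances zs zs' eqs eqs' As As' g g') {z : ℕ} (hz : z ∈ zs) :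
    z ∉ eqs.map Prod.fst ∧ z ∉ zs' :=
  ⟨fun h => H.left.fst_notMem_bound h hz, H.apart.bound z hz⟩

/-- Through an occurrence of `z`, the variables of `g z` occur in an atom or right side of the other
form, or are a left side of the first; none of these is in `zs`. -/
theorem Instances.notMem_bound_of_mem (H : Instances zs zs' eqs eqs' As As' g g') {z y : ℕ}
    (hz : z ∈ zs) (hy : y ∈ (g z).varFinset) : y ∉ zs := by
  intro hyz
  obtain ⟨e, he, hxe⟩ | ⟨A, hA, hxA⟩ := H.left.occurs z hz
  · have he1 : e.1 ∈ eqs.map Prod.fst := List.mem_map_of_mem he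
    have h1 := H.eq_subst' e.1 (H.left.fst_notMem_bound he1)
    rw [H.left.solution_eq he] at h1
    have h2 : y ∈ (solution eqs' e.1).varFinset := by
      rw [h1]
      exact mem_varFinset_subst.2 ⟨z, hxe, hy⟩
    by_cases h3 : e.1 ∈ eqs'.map Prod.fst
    · exact H.apart.notMem_snd hyz (solution_mem h3) h2
    · rw [solution_of_notMem h3] at h2
      obtain rfl : y = e.1 := by simpa using h2
      exact H.left.fst_notMem_bound he1 hyz
  · obtain ⟨i, hi⟩ := GAtom.mem_vars.1 hxA
    exact H.apart.notMem_atom hyz (atom_subst_mem H.atoms' hA)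
      (GAtom.mem_vars.2 ⟨i, mem_varFinset_subst.2 ⟨z, hi, hy⟩⟩)

theorem Instances.ren_mem (H : Instances zs zs' eqs eqs' As As' g g') {z : ℕ} (hz : z ∈ zs) :
    H.ren z ∈ zs' := by
  obtain ⟨h1, h2⟩ := H.good_bound hz
  obtain ⟨h3, h4⟩ := H.eq_ren h1 h2
  -- If the image were free on the right, `g'` would be `solution eqs` there. The left form would
  -- then contain an equation with the bare bound variable `z` on the right, which solved forms
  -- forbid, or the image would be `z` itself.
  by_contra hp
  have hpz : H.ren z ∉ zs := H.notMem_bound_of_mem hz (by simp [h3])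
  rw [H.agree _ hp] at h4
  by_cases hX : H.ren z ∈ eqs.map Prod.fst
  · exact H.left.ne_var z hz _ (solution_mem hX) h4
  · rw [solution_of_notMem hX] at h4
    rw [Term.var.inj h4] at hpz
    exact hpz hz

theorem Instances.ren_ren (H : Instances zs zs' eqs eqs' As As' g g') {z : ℕ} (hz : z ∈ zs) :
    H.symm.ren (H.ren z) = z := by
  obtain ⟨h1, h2⟩ := H.good_bound hz
  obtain ⟨h3, h4⟩ := H.eq_ren h1 h2
  obtain ⟨h5, h6⟩ := H.symm.good_bound (H.ren_mem hz)
  exact Term.var.inj ((H.symm.eq_ren h5 h6).1.symm.trans h4)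

theorem Instances.map_ren_perm (H : Instances zs zs' eqs eqs' As As' g g') :
    (zs.map H.ren).Perm zs' := by
  have hnd : (zs.map H.ren).Nodup := List.Nodup.map_on (fun x hx y hy h => by
    rw [← H.ren_ren hx, h, H.ren_ren hy]) H.left.nodup_bound
  refine (List.perm_ext_iff_of_nodup hnd H.right.nodup_bound).2 fun z => ⟨fun hz => ?_, fun hz => ?_⟩
  · obtain ⟨y, hy, rfl⟩ := List.mem_map.1 hz
    exact H.ren_mem hy
  · exact List.mem_map.2 ⟨_, H.symm.ren_mem hz, H.symm.ren_ren hz⟩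

/-- The right side of the equation for `x`, if it is a variable. -/
noncomputable def rhsVar (eqs : List (ℕ × Tm L)) (x : ℕ) : ℕ :=
  open Classical in if h : ∃ y, solution eqs x = Term.var y then h.choose else x

theorem rhsVar_eq {x y : ℕ} (h : solution eqs x = Term.var y) : rhsVar eqs x = y := by
  have h2 : ∃ y, solution eqs x = Term.var y := ⟨y, h⟩
  rw [rhsVar, dif_pos h2]
  exact Term.var.inj (h2.choose_spec.symm.trans h)

/-- The equation for `x` is to be redirected. -/
def Redirected (eqs eqs' : List (ℕ × Tm L)) (x : ℕ) : Prop :=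
  x ∈ eqs.map Prod.fst ∧ x ∉ eqs'.map Prod.fst ∧ ∃ y, solution eqs x = Term.var y

/-- The equations to be redirected. -/
noncomputable def redirections (eqs eqs' : List (ℕ × Tm L)) : List (ℕ × ℕ) :=
  open Classical in
  ((eqs.map Prod.fst).filter fun x => Redirected eqs eqs' x).map fun x => (x, rhsVar eqs x)

theorem mem_redirections {p : ℕ × ℕ} : p ∈ redirections eqs eqs' ↔
    Redirected eqs eqs' p.1 ∧ solution eqs p.1 = Term.var p.2 := by
  classical
  simp only [redirections, List.mem_map, List.mem_filter, decide_eq_true_eq]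
  constructor
  · rintro ⟨x, ⟨-, hx⟩, rfl⟩
    obtain ⟨y, hy⟩ := hx.2.2
    exact ⟨hx, by rw [hy, rhsVar_eq hy]⟩
  · rintro ⟨h1, h2⟩
    exact ⟨p.1, ⟨List.mem_map.1 h1.1, h1⟩, by rw [rhsVar_eq h2]⟩

/-- The other form is an instance of this one, so every identification of free variables made by
`eqs` is also made by `eqs'`. -/
theorem Instances.solution_congr (H : Instances zs zs' eqs eqs' As As' g g') {x y : ℕ}
    (hx : x ∉ zs) (hy : y ∉ zs) (h : solution eqs x = solution eqs y) :
    solution eqs' x = solution eqs' y := by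
  rw [H.eq_subst' x hx, H.eq_subst' y hy, h]

theorem Instances.rhs_notMem (H : Instances zs zs' eqs eqs' As As' g g') {x y : ℕ}
    (hx : x ∈ eqs.map Prod.fst) (hy : solution eqs x = Term.var y) :
    y ∉ eqs.map Prod.fst ∧ y ∉ zs ∧ y ∉ zs' := by
  have h1 := solution_mem hx
  rw [hy] at h1
  exact ⟨fun h => H.left.notMem_eqs y h _ h1 (by simp), fun h => H.left.ne_var y h _ h1 rfl,
    fun h => H.apart'.notMem_snd h h1 (by simp)⟩

/-- Two redirected variables with the same right side would be identified by `eqs`, hence by `eqs'`,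
which eliminates neither. A right side is never a left side in a solved form. -/
theorem Instances.nodup_redirections (H : Instances zs zs' eqs eqs' As As' g g') :
    ((redirections eqs eqs').map Prod.fst ++ (redirections eqs eqs').map Prod.snd).Nodup := by
  classical
  have h1 : (redirections eqs eqs').map Prod.fst =
      (eqs.map Prod.fst).filter fun x => Redirected eqs eqs' x := by
    simp [redirections, List.map_map, Function.comp_def]
  have hnd : ((redirections eqs eqs').map Prod.fst).Nodup := by
    rw [h1]
    exact H.left.nodup_fst.filter _
  refine List.nodup_append.2 ⟨hnd, ?_, ?_⟩
  · refine List.Nodup.map_on (fun p hp q hq hpq => ?_) hnd.of_map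
    obtain ⟨hp1, hp2⟩ := mem_redirections.1 hp
    obtain ⟨hq1, hq2⟩ := mem_redirections.1 hq
    have := H.solution_congr (H.left.fst_notMem_bound hp1.1) (H.left.fst_notMem_bound hq1.1)
      (by rw [hp2, hq2, hpq])
    rw [solution_of_notMem hp1.2.1, solution_of_notMem hq1.2.1] at this
    exact Prod.ext (Term.var.inj this) hpq
  · intro x hx y hy hxy
    obtain ⟨p, hp, rfl⟩ := List.mem_map.1 hx
    obtain ⟨q, hq, rfl⟩ := List.mem_map.1 hy
    obtain ⟨hp1, hp2⟩ := mem_redirections.1 hp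
    obtain ⟨hq1, hq2⟩ := mem_redirections.1 hq
    exact (H.rhs_notMem hq1.1 hq2).1 (hxy ▸ hp1.1)

theorem Instances.swapVar_fst (H : Instances zs zs' eqs eqs' As As' g g') {x y : ℕ}
    (hx : Redirected eqs eqs' x) (hy : solution eqs x = Term.var y) :
    swapVar (redirections eqs eqs') x = y ∧ swapVar (redirections eqs eqs') y = x :=
  swapVar_mem H.nodup_redirections (p := (x, y)) (mem_redirections.2 ⟨hx, hy⟩)

theorem swapVar_redirections_of {w : ℕ} (h1 : ¬ Redirected eqs eqs' w)
    (h2 : ∀ x, Redirected eqs eqs' x → solution eqs x ≠ Term.var w) :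
    swapVar (redirections eqs eqs') w = w := by
  refine swapVar_of_notMem (fun h => ?_) fun h => ?_
  · obtain ⟨p, hp, rfl⟩ := List.mem_map.1 h
    exact h1 (mem_redirections.1 hp).1
  · obtain ⟨p, hp, rfl⟩ := List.mem_map.1 h
    exact h2 p.1 (mem_redirections.1 hp).1 (mem_redirections.1 hp).2

theorem Instances.swapVar_bound (H : Instances zs zs' eqs eqs' As As' g g') {z : ℕ}
    (hz : z ∈ zs) : swapVar (redirections eqs eqs') z = z :=
  swapVar_redirections_of (fun h => H.left.fst_notMem_bound h.1 hz) fun _ hx h =>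
    (H.rhs_notMem hx.1 h).2.1 hz

/-- On the left `w` is its own value, and this is an instance of its right side in `eqs'`; so that
side is a variable `y`. Since `g'` sends `y` to `w`, the left form contains the reversed equation y
= w. -/
theorem Instances.exists_redirected (H : Instances zs zs' eqs eqs' As As' g g') {w : ℕ}
    (h1 : w ∉ zs') (h2 : w ∉ eqs.map Prod.fst) (h3 : w ∈ eqs'.map Prod.fst) :
    ∃ y, Redirected eqs eqs' y ∧ solution eqs y = Term.var w ∧
      solution eqs' w = Term.var y ∧ y ∉ zs := by
  have h4 := H.eq_subst w h1
  rw [solution_of_notMem h2] at h4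
  cases h5 : solution eqs' w with
  | func f ts =>
    rw [h5] at h4
    simp [Term.subst] at h4
  | var y =>
    obtain ⟨h6, h7, h8⟩ := H.symm.rhs_notMem h3 h5
    have h9 : solution eqs y = Term.var w := by
      rw [h5] at h4
      rw [← H.agree y h7]
      exact h4.symm
    refine ⟨y, ⟨?_, h6, w, h9⟩, h9, rfl, h8⟩
    by_contra hy
    rw [solution_of_notMem hy] at h9
    exact h6 ((Term.var.inj h9) ▸ h3)

/-- Redirection followed by the renaming of the bound variables. -/
noncomputable def Instances.total (H : Instances zs zs' eqs eqs' As As' g g') (x : ℕ) : Tm L :=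
  ((swap (redirections eqs eqs') : ℕ → Tm L) x).subst (rename H.ren zs)

/-- On a bound variable only the renaming acts, as `g` does. A free `w` eliminated only on the right
is the target of a redirection, and `g w` is its partner; any other `w` here is fixed by both. -/
theorem Instances.total_eq (H : Instances zs zs' eqs eqs' As As' g g') {w : ℕ}
    (h1 : w ∉ eqs.map Prod.fst) (h2 : w ∉ zs') : H.total w = g w := by
  rw [Instances.total, swap_eq_var, Term.subst]
  by_cases hz : w ∈ zs
  · rw [H.swapVar_bound hz, (H.eq_ren h1 h2).1]
    simp [rename, hz]
  · rw [H.agree' w hz]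
    by_cases hX : w ∈ eqs'.map Prod.fst
    · obtain ⟨y, hy1, hy2, hy3, hy4⟩ := H.exists_redirected h2 h1 hX
      rw [(H.swapVar_fst hy1 hy2).2, hy3]
      simp [rename, hy4]
    · rw [swapVar_redirections_of (fun h => h1 h.1), solution_of_notMem hX]
      · simp [rename, hz]
      · intro x hx h
        have := H.solution_congr (H.left.fst_notMem_bound hx.1) hz
          (h.trans (solution_of_notMem h1).symm)
        rw [solution_of_notMem hx.2.1, solution_of_notMem hX] at this
        exact h1 (Term.var.inj this ▸ hx.1)

theorem Instances.substAtoms_total (H : Instances zs zs' eqs eqs' As As' g g') :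
    substAtoms H.total As = As' := by
  refine Eq.trans (List.map_congr_left fun A hA => ?_) H.atoms'
  simp only [GAtom.map]
  congr 1
  funext i
  refine subst_congr_vars fun x hx => H.total_eq (fun h => ?_) fun h => ?_
  · exact H.left.notMem_atoms x h A hA (GAtom.mem_vars.2 ⟨i, hx⟩)
  · exact H.apart'.notMem_atom h hA (GAtom.mem_vars.2 ⟨i, hx⟩)

/-- The right side becomes the value of `e.1` under `eqs'`. If `e.1` is redirected, its partner has
the same value there and is eliminated by `eqs'`; otherwise `e.1` itself is, since failing that its
right side would be a variable and the equation redirected. -/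
theorem Instances.mem_total (H : Instances zs zs' eqs eqs' As As' g g') {e : ℕ × Tm L}
    (he : e ∈ eqs) : (swapVar (redirections eqs eqs') e.1, e.2.subst H.total) ∈ eqs' := by
  have hx : e.1 ∈ eqs.map Prod.fst := List.mem_map_of_mem he
  have hxz := H.left.fst_notMem_bound hx
  have h1 : e.2.subst H.total = solution eqs' e.1 := by
    rw [H.eq_subst' _ hxz, H.left.solution_eq he]
    exact subst_congr_vars fun x hx => H.total_eq (fun h => H.left.notMem_eqs x h e he hx)
      fun h => H.apart'.notMem_snd h he hx
  rw [h1]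
  generalize e.1 = x at *
  by_cases hr : Redirected eqs eqs' x
  · obtain ⟨y, hy⟩ := hr.2.2
    obtain ⟨hy1, hy2, -⟩ := H.rhs_notMem hx hy
    rw [(H.swapVar_fst hr hy).1]
    have h2 := H.solution_congr hxz hy2 (hy.trans (solution_of_notMem hy1).symm)
    rw [h2]
    refine solution_mem ?_
    by_contra hy'
    rw [solution_of_notMem hr.2.1, solution_of_notMem hy'] at h2
    exact hy1 (Term.var.inj h2 ▸ hx)
  · rw [swapVar_redirections_of hr fun z hz h => (H.rhs_notMem hz.1 h).1 hx]
    refine solution_mem ?_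
    by_contra hx'
    refine hr ⟨hx, hx', ?_⟩
    have h2 := H.eq_subst' x hxz
    rw [solution_of_notMem hx'] at h2
    cases h3 : solution eqs x with
    | var y => exact ⟨y, rfl⟩
    | func f ts =>
      rw [h3] at h2
      simp [Term.subst] at h2

/-- Both lists have distinct left sides, so it suffices to compare members. Each left side of `eqs'`
comes from `eqs`, either unchanged or by redirection, and it determines its equation. -/
theorem Instances.eqs_perm (H : Instances zs zs' eqs eqs' As As' g g') :
    (mapEqs (swapVar (redirections eqs eqs')) H.total eqs).Perm eqs' := by
  have hfst : (mapEqs (swapVar (redirections eqs eqs')) H.total eqs).map Prod.fst =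
      (eqs.map Prod.fst).map (swapVar (redirections eqs eqs')) := by
    simp [mapEqs, List.map_map, Function.comp_def]
  have hnd : ((mapEqs (swapVar (redirections eqs eqs')) H.total eqs).map Prod.fst).Nodup := by
    rw [hfst]
    exact H.left.nodup_fst.map
      (Function.LeftInverse.injective (swapVar_swapVar H.nodup_redirections))
  refine (List.perm_ext_iff_of_nodup hnd.of_map H.right.nodup_fst.of_map).2 fun e =>
    ⟨fun he => ?_, fun he => ?_⟩
  · obtain ⟨e', he', rfl⟩ := List.mem_map.1 he
    exact H.mem_total he'
  · have hx : e.1 ∈ eqs'.map Prod.fst := List.mem_map_of_mem he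
    have : ∃ x ∈ eqs.map Prod.fst, swapVar (redirections eqs eqs') x = e.1 := by
      by_cases h1 : e.1 ∈ eqs.map Prod.fst
      · exact ⟨e.1, h1, swapVar_redirections_of (fun h => h.2.1 hx) fun z hz h =>
          (H.rhs_notMem hz.1 h).1 h1⟩
      · obtain ⟨y, hy1, hy2, -⟩ := H.exists_redirected (H.right.fst_notMem_bound hx) h1 hx
        exact ⟨y, hy1.1, (H.swapVar_fst hy1 hy2).1⟩
    obtain ⟨x, hx1, hx2⟩ := this
    have h1 := H.mem_total (solution_mem hx1)
    have h2 := snd_eq_of_nodup H.right.nodup_fst (x := e.1) (hx2 ▸ h1) he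
    exact List.mem_map.2 ⟨_, solution_mem hx1, Prod.ext hx2 h2⟩

end IsSolved

end SolvedForms

/-! ### Construction of the isomorphism -/

section Isomorphisms

variable {zs zs' : List ℕ} {eqs eqs' : List (ℕ × Tm L)} {As As' : List (GAtom L (Tm L))}

/-- One step of an isomorphism. -/
def IsoStep (R R' : Query L) : Prop := PermStep R R' ∨ Variant R R' ∨ RedirectStep R R'

theorem mapEqs_mapEqs (τ τ' : ℕ → ℕ) (σ σ' : ℕ → Tm L) (eqs : List (ℕ × Tm L)) :
    mapEqs τ' σ' (mapEqs τ σ eqs) = mapEqs (τ' ∘ τ) (fun x => (σ x).subst σ') eqs := by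
  simp [mapEqs, List.map_map, Function.comp_def, subst_subst]

theorem substAtoms_substAtoms (σ σ' : ℕ → Tm L) (As : List (GAtom L (Tm L))) :
    substAtoms σ' (substAtoms σ As) = substAtoms (fun x => (σ x).subst σ') As := by
  simp [substAtoms, List.map_map, Function.comp_def, GAtom.map_map, subst_subst]

theorem varEqs_mapEqs {τ : ℕ → ℕ} {σ : ℕ → Tm L}
    (h : ∀ x ∈ eqs.map Prod.fst, σ x = Term.var (τ x)) :
    varEqs (mapEqs τ σ eqs) = substEqs σ (varEqs eqs) := by
  simp only [varEqs, mapEqs, substEqs, List.map_map]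
  refine List.map_congr_left fun e he => ?_
  simp [Term.subst, h e.1 (List.mem_map_of_mem he)]

theorem rename_fst (H : IsSolved zs eqs As) (ρ : ℕ → ℕ) :
    ∀ x ∈ eqs.map Prod.fst, (rename ρ zs : ℕ → Tm L) x = Term.var (id x) := by
  intro x hx
  simp [rename, H.fst_notMem_bound hx]

/-- Shifting the bound variables of a solved form by a sufficiently large number. -/
theorem IsSolved.shift (H : IsSolved zs eqs As) {k : ℕ}
    (hk : ∀ x, BodyVar (varEqs eqs) As x → x < k) :
    IsSolved (zs.map (· + k)) (mapEqs id (rename (· + k) zs) eqs)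
      (substAtoms (rename (· + k) zs) As) := by
  have hfst : (mapEqs id (rename (· + k) zs) eqs).map Prod.fst = eqs.map Prod.fst := by
    simp [mapEqs, List.map_map, Function.comp_def]
  have hX : ∀ x ∈ eqs.map Prod.fst, x < k := by
    intro x hx
    obtain ⟨e, he, rfl⟩ := List.mem_map.1 hx
    exact hk _ (.inl ⟨_, List.mem_map_of_mem he, .inl (by simp)⟩)
  have hmem : ∀ x ∈ eqs.map Prod.fst, ∀ y, x ∈ ((rename (· + k) zs : ℕ → Tm L) y).varFinset →
      x = y := by
    intro x hx y hy
    simp only [rename, Term.varFinset, Finset.mem_singleton] at hy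
    have := hX x hx
    split_ifs at hy
    · omega
    · exact hy
  constructor
  · rw [hfst]
    refine List.nodup_append.2 ⟨H.nodup_fst, H.nodup_bound.map fun a b h => by simpa using h, ?_⟩
    intro x hx y hy hxy
    obtain ⟨z, -, rfl⟩ := List.mem_map.1 hy
    have := hX x hx
    omega
  · rw [hfst]
    intro x hx e he hxe
    obtain ⟨e', he', rfl⟩ := List.mem_map.1 he
    obtain ⟨y, hy, hxy⟩ := mem_varFinset_subst.1 hxe
    obtain rfl := hmem x hx y hxy
    exact H.notMem_eqs _ hx e' he' hy
  · rw [hfst]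
    intro x hx A hA hxA
    obtain ⟨A', hA', rfl⟩ := List.mem_map.1 hA
    obtain ⟨i, hi⟩ := GAtom.mem_vars.1 hxA
    obtain ⟨y, hy, hxy⟩ := mem_varFinset_subst.1 hi
    obtain rfl := hmem x hx y hxy
    exact H.notMem_atoms _ hx A' hA' (GAtom.mem_vars.2 ⟨i, hy⟩)
  · intro z hz'
    obtain ⟨y, hy, rfl⟩ := List.mem_map.1 hz'
    obtain ⟨e, he, h⟩ | ⟨A, hA, h⟩ := H.occurs y hy
    · exact .inl ⟨_, List.mem_map_of_mem he, mem_varFinset_subst.2 ⟨y, h, by simp [rename, hy]⟩⟩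
    · obtain ⟨i, hi⟩ := GAtom.mem_vars.1 h
      exact .inr ⟨_, List.mem_map_of_mem hA,
        GAtom.mem_vars.2 ⟨i, mem_varFinset_subst.2 ⟨y, hi, by simp [rename, hy]⟩⟩⟩
  · intro z hz' e he h
    obtain ⟨y, hy, rfl⟩ := List.mem_map.1 hz'
    obtain ⟨⟨x, s⟩, hs, rfl⟩ := List.mem_map.1 he
    cases s with
    | func f ts => simp [Term.subst] at h
    | var w =>
      simp only [Term.subst, rename, Term.var.injEq] at h
      split_ifs at h with hw
      · exact H.ne_var w hw _ hs rfl
      · have := hk w (.inl ⟨_, List.mem_map_of_mem hs, .inr (by simp)⟩)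
        omega

theorem bodyVar_mapEqs_rename (H : IsSolved zs eqs As) {ρ : ℕ → ℕ} {y : ℕ}
    (hy : BodyVar (varEqs (mapEqs id (rename ρ zs) eqs)) (substAtoms (rename ρ zs) As) y) :
    y ∈ zs.map ρ ∨ (BodyVar (varEqs eqs) As y ∧ y ∉ zs) := by
  rw [varEqs_mapEqs (rename_fst H ρ)] at hy
  exact bodyVar_rename hy

theorem IsSolved.exSat_shift {J : Type w} [(fnPart L).Structure J] (H : IsSolved zs eqs As)
    {k : ℕ} (hk : ∀ x, BodyVar (varEqs eqs) As x → x < k) (h : ℕ → J) (Is : List (Interp L J)) :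
    ExSat (zs.map (· + k)) (varEqs (mapEqs id (rename (· + k) zs) eqs))
      (substAtoms (rename (· + k) zs) As) h Is ↔ ExSat zs (varEqs eqs) As h Is := by
  rw [varEqs_mapEqs (rename_fst H _)]
  refine exSat_rename (fun x _ y _ h => Nat.add_right_cancel h) fun x hx hz => ?_
  obtain ⟨y, -, rfl⟩ := List.mem_map.1 hz
  have := hk _ hx
  omega

/-- Solved forms with the same solutions and with fresh bound variables are isomorphic. -/
theorem IsSolved.reflTransGen_of_apart {Q : Query L} (hQ : Q.HasForm zs eqs As)
    (H : IsSolved zs eqs As) (H' : IsSolved zs' eqs' As') (ha : IsSolved.Apart zs zs' eqs' As')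
    (ha' : IsSolved.Apart zs' zs eqs As) (hlen : As.length = As'.length)
    (hiff : ∀ (h : ℕ → Tm L) (Is : List (Interp L (Tm L))), Is.length = As.length →
      (ExSat zs (varEqs eqs) As h Is ↔ ExSat zs' (varEqs eqs') As' h Is))
    {Q' : Query L} (hQ' : Q'.HasForm zs' eqs' As') : Relation.ReflTransGen IsoStep Q Q' := by
  obtain ⟨g', h1, h2, h3⟩ := H.exists_instance fun h Is hI => (hiff h Is hI).1
  obtain ⟨g, h1', h2', h3'⟩ := H'.exists_instance fun h Is hI => (hiff h Is (hI.trans hlen.symm)).2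
  have I : IsSolved.Instances zs zs' eqs eqs' As As' g g' :=
    ⟨H, H', ha, ha', h1, h1', h2, h2', h3, h3'⟩
  obtain ⟨Q₁, hs₁, hQ₁⟩ := hQ.exists_redirectStep (ps := IsSolved.redirections eqs eqs')
    (fun p hp => by
      obtain ⟨hp1, hp2⟩ := IsSolved.mem_redirections.1 hp
      rw [← hp2]
      exact solution_mem hp1.1)
    I.nodup_redirections (fun z hz => I.swapVar_bound hz)
  -- The exchange fixes the variables in `zs'`, so they are still absent after redirection and may
  -- serve as new bound variables.
  have hX : ∀ y, BodyVar (varEqs (mapEqs (swapVar (IsSolved.redirections eqs eqs'))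
      (swap (IsSolved.redirections eqs eqs')) eqs))
      (substAtoms (swap (IsSolved.redirections eqs eqs')) As) y → y ∉ zs' := by
    intro y hy hz
    rw [varEqs_mapEqs (fun x _ => swap_eq_var _ x)] at hy
    obtain ⟨x, hx, hyx⟩ := bodyVar_subst.1 hy
    rw [swap_eq_var] at hyx
    obtain rfl : y = _ := by simpa using hyx
    have hfix := IsSolved.swapVar_redirections_of (eqs := eqs) (eqs' := eqs')
      (fun h => ha'.notMem_fst hz h.1) fun x hx h => (I.rhs_notMem hx.1 h).2.2 hz
    rw [swapVar_swapVar I.nodup_redirections] at hfix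
    rw [← hfix] at hz
    exact ha'.body _ hz hx
  obtain ⟨Q₂, hs₂, hQ₂⟩ := hQ₁.exists_variant (ρ := I.ren) H.nodup_bound (by
      intro x hx hz
      obtain ⟨e', he', rfl⟩ := List.mem_map.1 hx
      obtain ⟨e, he, rfl⟩ := List.mem_map.1 he'
      have h4 := swapVar_swapVar I.nodup_redirections e.1
      rw [show swapVar _ (swapVar _ e.1) = _ from I.swapVar_bound hz] at h4
      simp only at hz
      rw [h4] at hz
      exact H.fst_notMem_bound (List.mem_map_of_mem he) hz)
    (I.map_ren_perm.nodup_iff.2 H'.nodup_bound)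
    (fun z hz h => ha.bound _ h (I.ren_mem hz)) fun z hz h => hX _ h (I.ren_mem hz)
  rw [mapEqs_mapEqs, substAtoms_substAtoms] at hQ₂
  have hAs := I.substAtoms_total
  have heqs := I.eqs_perm
  refine ((Relation.ReflTransGen.single (.inr (.inr hs₁))).tail (.inr (.inl hs₂))).tail (.inl ?_)
  refine ⟨_, zs', _, eqs', _, hQ₂, ?_, I.map_ren_perm, heqs⟩
  change Q'.HasForm zs' eqs' (substAtoms I.total As)
  rwa [hAs]

theorem isSolved_of_solved {Q : Query L} (h : Q.Solved) : Q = tru ∨ Q = fls ∨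
    ∃ (zs : List ℕ) (eqs : List (ℕ × Tm L)) (As : List (GAtom L (Tm L))),
      Q.HasForm zs eqs As ∧ IsSolved zs eqs As := by
  obtain h | h | ⟨zs, eqs, As, h1, h2, h3, h4, h5⟩ := h
  · exact .inl h
  · exact .inr (.inl h)
  · exact .inr (.inr ⟨zs, eqs, As, h1, h2, fun x hx => (h3 x hx).1, fun x hx => (h3 x hx).2, h4, h5⟩)

/-- Shifting the bound variables of a solved form there and back. -/
theorem IsSolved.shift_back (H : IsSolved zs eqs As) {k : ℕ} (hz : ∀ z ∈ zs, z < k)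
    (hk : ∀ x, BodyVar (varEqs eqs) As x → x < k) {Q : Query L}
    (hQ : Q.HasForm (zs.map (· + k)) (mapEqs id (rename (· + k) zs) eqs)
      (substAtoms (rename (· + k) zs) As)) : ∃ Q', Variant Q Q' ∧ Q'.HasForm zs eqs As := by
  have hid : (zs.map (· + k)).map (· - k) = zs := by simp [List.map_map, Function.comp_def]
  have hS := H.shift hk
  obtain ⟨Q', h1, h2⟩ := hQ.exists_variant (ρ := (· - k)) hS.nodup_bound
    (fun x hx => hS.fst_notMem_bound hx) (by rw [hid]; exact H.nodup_bound) (by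
      intro z hz' h
      obtain ⟨y, hy, rfl⟩ := List.mem_map.1 hz'
      obtain ⟨w, hw, h⟩ := List.mem_map.1 h
      have := hz y hy
      omega) (by
      intro z hz' h
      obtain ⟨y, hy, rfl⟩ := List.mem_map.1 hz'
      have hlt := hz y hy
      obtain h | h := bodyVar_mapEqs_rename H h
      · obtain ⟨w, hw, h⟩ := List.mem_map.1 h
        omega
      · simp only [Nat.add_sub_cancel] at h
        exact h.2 hy)
  refine ⟨Q', h1, ?_⟩
  -- Subtraction undoes the shift on bound variables, and a free variable, being below `k`, is not
  -- mistaken for a shifted one.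
  have hs : ∀ x, BodyVar (varEqs eqs) As x → ((rename (· + k) zs : ℕ → Tm L) x).subst
      (rename (· - k) (zs.map (· + k))) = Term.var x := by
    intro x hx
    simp only [rename, Term.subst]
    by_cases hxz : x ∈ zs
    · simp [hxz]
    · have : x ∉ zs.map (· + k) := by
        intro h
        obtain ⟨w, -, rfl⟩ := List.mem_map.1 h
        have := hk _ hx
        omega
      simp only [hxz, this, if_false]
  rw [hid, mapEqs_mapEqs, substAtoms_substAtoms] at h2
  convert h2 using 1
  · conv_lhs => rw [← List.map_id eqs]
    refine List.map_congr_left fun e he => ?_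
    refine Prod.ext rfl (subst_eq_self fun x hx => ?_).symm
    exact hs x (.inl ⟨_, List.mem_map_of_mem he, .inr hx⟩)
  · exact (substAtoms_eq_self fun A hA x hx => hs x (.inr ⟨A, hA, hx⟩)).symm

theorem IsSolved.reflTransGen {Q Q' : Query L} (hQ : Q.HasForm zs eqs As)
    (H : IsSolved zs eqs As) (hQ' : Q'.HasForm zs' eqs' As') (H' : IsSolved zs' eqs' As')
    (hlen : As.length = As'.length)
    (hiff : ∀ (h : ℕ → Tm L) (Is : List (Interp L (Tm L))), Is.length = As.length →
      (ExSat zs (varEqs eqs) As h Is ↔ ExSat zs' (varEqs eqs') As' h Is)) :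
    Relation.ReflTransGen IsoStep Q Q' := by
  obtain ⟨b, hb1, hb2⟩ := exists_lt_of_bodyVar (varEqs eqs) As zs
  obtain ⟨b', hb1', hb2'⟩ := exists_lt_of_bodyVar (varEqs eqs') As' zs'
  obtain ⟨k, hkb, hkb'⟩ : ∃ k, b ≤ k ∧ b' ≤ k := ⟨max b b', le_max_left _ _, le_max_right _ _⟩
  have hz : ∀ z ∈ zs, z < k := fun z hz => (hb1 z hz).trans_le hkb
  have hk : ∀ x, BodyVar (varEqs eqs) As x → x < k := fun x hx => (hb2 x hx).trans_le hkb
  have hz' : ∀ z ∈ zs', z < k + k := fun z hz => (hb1' z hz).trans_le (by omega)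
  have hk' : ∀ x, BodyVar (varEqs eqs') As' x → x < k := fun x hx => (hb2' x hx).trans_le hkb'
  have hk2' : ∀ x, BodyVar (varEqs eqs') As' x → x < k + k :=
    fun x hx => (hk' x hx).trans_le (by omega)
  have hfresh : ∀ {zs : List ℕ} {eqs : List (ℕ × Tm L)} {As : List (GAtom L (Tm L))} {Q : Query L}
      {k : ℕ}, Q.HasForm zs eqs As → IsSolved zs eqs As → (∀ z ∈ zs, z < k) →
      (∀ x, BodyVar (varEqs eqs) As x → x < k) → ∃ Q', Variant Q Q' ∧
        Q'.HasForm (zs.map (· + k)) (mapEqs id (rename (· + k) zs) eqs)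
          (substAtoms (rename (· + k) zs) As) := by
    intro zs eqs As Q k hQ H hz hk
    refine hQ.exists_variant H.nodup_bound (fun x hx => H.fst_notMem_bound hx)
      (H.nodup_bound.map fun a b h => by simpa using h) (fun z hz1 h => ?_) fun z hz1 h => ?_
    · have := hz _ h
      omega
    · have := hk _ h
      omega
  obtain ⟨Q₁, hv, hQ₁⟩ := hfresh hQ H hz hk
  -- Shifting one form by k and the other by 2k puts the bound variables of the first in [k, 2k) and
  -- those of the second at 2k or above. Only the shape of `Q₂` is kept: the chain must run from
  -- `Q₂` to `Q'`, and `shift_back` supplies the renaming in that direction.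
  obtain ⟨Q₂, -, hQ₂⟩ := hfresh hQ' H' hz' hk2'
  have main := IsSolved.reflTransGen_of_apart hQ₁ (H.shift hk) (H'.shift hk2')
    ⟨fun z h h' => by
      obtain ⟨y, hy, rfl⟩ := List.mem_map.1 h
      obtain ⟨w, hw, h'⟩ := List.mem_map.1 h'
      have := hz y hy
      omega, fun z h h' => by
      obtain ⟨y, hy, rfl⟩ := List.mem_map.1 h
      have := hz y hy
      obtain h' | ⟨h', -⟩ := bodyVar_mapEqs_rename H' h'
      · obtain ⟨w, hw, h'⟩ := List.mem_map.1 h'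
        omega
      · have := hk' _ h'
        omega⟩
    ⟨fun z h h' => by
      obtain ⟨y, hy, rfl⟩ := List.mem_map.1 h
      obtain ⟨w, hw, h'⟩ := List.mem_map.1 h'
      have := hz w hw
      omega, fun z h h' => by
      obtain ⟨y, hy, rfl⟩ := List.mem_map.1 h
      obtain h' | ⟨h', -⟩ := bodyVar_mapEqs_rename H h'
      · obtain ⟨w, hw, h'⟩ := List.mem_map.1 h'
        have := hz w hw
        omega
      · have := hk _ h'
        omega⟩
    (by simpa [substAtoms] using hlen)
    (fun h Is hI => by
      rw [H.exSat_shift hk, H'.exSat_shift hk2']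
      exact hiff h Is (by simpa [substAtoms] using hI)) hQ₂
  obtain ⟨Q₃, hv3, hQ₃⟩ := H'.shift_back hz' hk2' hQ₂
  refine ((Relation.ReflTransGen.single (.inr (.inl hv))).trans main).trans
    ((Relation.ReflTransGen.single (.inr (.inl hv3))).tail (.inl ?_))
  -- The two queries can differ only in bracketing, which a trivial permutation step absorbs.
  exact ⟨zs', zs', eqs', eqs', As', hQ₃, hQ', .refl _, .refl _⟩

theorem HasForm.ne_nil {Q : Query L} (hQ : Q.HasForm zs eqs As) : eqs ≠ [] ∨ As ≠ [] := by
  by_contra! h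
  obtain ⟨rfl, rfl⟩ := h
  obtain ⟨B, -, hB⟩ := hQ
  have : ∀ B : Query L, B.conjuncts ≠ [] := by
    intro B
    induction B with
    | and B₁ B₂ ih₁ ih₂ => simp [conjuncts, ih₁]
    | _ => simp [conjuncts]
  exact this B hB

/-- The valuation sending each variable to itself violates any solved equation x = s: `s` is neither
`x` nor a bound variable. Such an equation exists because there are no atoms and a conjunction is
never empty. -/
theorem IsSolved.not_equivJ_tru {Q : Query L} (hQ : Q.HasForm zs eqs As)
    (H : IsSolved zs eqs As) : ¬ EquivJ (Tm L) Q tru := by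
  rintro ⟨h1, h2⟩
  have hc : As.length = 0 := hQ.card_eq ▸ h1
  obtain rfl : As = [] := List.length_eq_zero_iff.1 hc
  obtain he | h := hQ.ne_nil
  swap
  · exact h rfl
  obtain ⟨⟨x, s⟩, he⟩ := List.exists_mem_of_ne_nil _ he
  have hx : x ∈ eqs.map Prod.fst := List.mem_map_of_mem (f := Prod.fst) he
  have h3 : (Term.var : ℕ → Tm L) ∈ Q.sol (Tm L) [] := by
    rw [h2 [] (by rw [h1]; rfl)]
    trivial
  rw [hQ.mem_sol_iff rfl] at h3
  obtain ⟨g, hg, hE, -⟩ := h3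
  have h4 := hE _ (List.mem_map_of_mem he)
  rw [Term.realize_var, realize_eq_subst, hg x (H.fst_notMem_bound hx)] at h4
  cases s with
  | func f ts => simp [Term.subst] at h4
  | var y =>
    rw [Term.subst, hg y fun hy => H.ne_var y hy _ he rfl] at h4
    exact H.notMem_eqs x hx _ he (by simp [Term.var.inj h4])

/-- The generic solution shows that a solved form is satisfiable. -/
theorem IsSolved.not_equivJ_fls {Q : Query L} (hQ : Q.HasForm zs eqs As)
    (H : IsSolved zs eqs As) : ¬ EquivJ (Tm L) Q fls := by
  rintro ⟨h1, h2⟩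
  have h3 := (hQ.mem_sol_iff (by simp)).2 H.exSat_solution
  rw [h2 _ (by rw [hQ.card_eq, List.length_map])] at h3
  exact h3

theorem EquivJ.symm {J : Type w} [(fnPart L).Structure J] {Q Q' : Query L} (h : EquivJ J Q Q') :
    EquivJ J Q' Q :=
  ⟨h.1.symm, fun Is hI => (h.2 Is (hI.trans h.1.symm)).symm⟩

theorem not_equivJ_tru_fls : ¬ EquivJ (Tm L) (tru : Query L) fls := by
  rintro ⟨-, h⟩
  have h3 : (Term.var : ℕ → Tm L) ∈ (tru : Query L).sol (Tm L) [] := trivial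
  rw [h [] rfl] at h3
  exact h3

/-- Queries in solved form with the same solutions in the model of terms are isomorphic. -/
theorem isomorphic_of_equivJ {Q Q' : Query L} (h : EquivJ (Tm L) Q Q') (hQ : Q.Solved)
    (hQ' : Q'.Solved) : Isomorphic Q Q' := by
  refine ⟨hQ, ?_⟩
  obtain rfl | rfl | ⟨zs, eqs, As, hF, hS⟩ := isSolved_of_solved hQ <;>
  obtain rfl | rfl | ⟨zs', eqs', As', hF', hS'⟩ := isSolved_of_solved hQ'
  · exact .refl
  · exact absurd h not_equivJ_tru_fls
  · exact absurd h.symm (hS'.not_equivJ_tru hF')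
  · exact absurd h.symm not_equivJ_tru_fls
  · exact .refl
  · exact absurd h.symm (hS'.not_equivJ_fls hF')
  · exact absurd h (hS.not_equivJ_tru hF)
  · exact absurd h (hS.not_equivJ_fls hF)
  · have hlen : As.length = As'.length := by rw [← hF.card_eq, ← hF'.card_eq, h.1]
    refine hS.reflTransGen hF hF' hS' hlen fun g Is hI => ?_
    rw [← hF.mem_sol_iff hI, ← hF'.mem_sol_iff (hI.trans hlen), h.2 Is (hI.trans hF.card_eq.symm)]

end Isomorphisms

end Query

end QueryLattice

theorem mainTheorem2 (L : FirstOrder.Language.{u, v}) (hL : Nonempty (L.Functions 0)) :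
    (∀ (J : Type w) [(QueryLattice.fnPart L).Structure J],
      Nontrivial J → QueryLattice.IsModelFEA L J →
      ∀ Q Q' : QueryLattice.Query L,
        (QueryLattice.Query.EquivJ J Q Q' ↔
          QueryLattice.Query.Equivalent.{u, v, max u w'} Q Q') ∧
        (QueryLattice.Query.LeJ J Q Q' ↔
          QueryLattice.Query.Le.{u, v, max u w'} Q Q')) ∧
    (∀ Q Q' : QueryLattice.Query L,
      QueryLattice.Query.Equivalent.{u, v, max u w'} Q Q' →
      Q.Solved → Q'.Solved → QueryLattice.Query.Isomorphic Q Q') := by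
  refine ⟨fun J _ _ hJ Q Q' => ⟨QueryLattice.Query.equivJ_iff_equivalent.{u, v, w, w'} hL hJ,
    QueryLattice.Query.leJ_iff_le.{u, v, w, w'} hL hJ⟩, fun Q Q' h hQ hQ' => ?_⟩
  have : Nontrivial (QueryLattice.Tm L) :=
    ⟨⟨FirstOrder.Language.Term.var 0, FirstOrder.Language.Term.var 1, by simp⟩⟩
  -- The first part, applied to the model of terms, turns equivalence over the models of the given
  -- universe into equality of solutions among terms.
  exact QueryLattice.Query.isomorphic_of_equivJ
    ((QueryLattice.Query.equivJ_iff_equivalent.{u, v, u, max w' u} hL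
      QueryLattice.isModelFEA_term).2 h) hQ hQ'
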